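/- Let $\mathbb K$ be a field of characteristic zero, and let $G$ be a finite graph without loops, possibly with multiple edges, on the vertex set $\{0,1,\dots,n\}$. For a set $I$ of vertices let $D_I$ be the number of edges of $G$ joining a vertex in $I$ to a vertex outside $I$. For a vertex $i$ and an edge $e$ put $c_{i,e}=1$ if $e$ joins $i$ to some $j>i$, $c_{i,e}=-1$ if $e$ joins $i$ to some $j<i$, and $c_{i,e}=0$ otherwise. Let $\Phi_G$ be the commutative $\mathbb K$-algebra generated by variables $\phi_e$, one for each edge $e$ of $G$, with defining relations $\phi_e^2=0$, and put $$X_i=\sum_{e} c_{i,e}\phi_e,\qquad Y_i=\exp(X_i)=\prod_{e}(1+c_{i,e}\phi_e)\qquad(0\le i\le n).$$ Consider the following $\mathbb K$-algebras: - $\mathcal B_G$, the quotient of $\mathbb K[x_1,\dots,x_n]$ by the ideal generated by $\bigl(\sum_{i\in I}x_i\bigr)^{D_I+1}$ for all nonempty $I\subseteq\{1,\dots,n\}$; - $\mathcal C_G$, the subalgebra of $\Phi_G$ generated by $X_1,\dots,X_n$; - $\mathcal D_G$, the quotient of $\mathbb K[y_0,\dots,y_n]$ by the ideal generated by $\bigl(\prod_{i\in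 I}y_i-1\bigr)^{D_I+1}$ for all nonempty $I\subseteq\{0,\dots,n\}$; - $\mathcal K_G$, the subalgebra of $\Phi_G$ generated by $Y_0,\dots,Y_n$. Theorem. The four algebras $\mathcal B_G$, $\mathcal C_G$, $\mathcal D_G$ and $\mathcal K_G$ are isomorphic as (non-filtered) $\mathbb K$-algebras. They are finite-dimensional over $\mathbb K$, and their dimension equals the number of spanning forests of $G$, that is, of subgraphs of $G$ that contain all vertices of $G$ and have no cycles. Moreover, $\mathcal C_G=\mathcal K_G$ as subsets of $\Phi_G$; and, putting $x_0=-(x_1+\dots+x_n)$, the elements $x_0,\dots,x_n$ of $\mathcal B_G$ are nilpotent and there is an isomorphism of $\mathbb K$-algebras $\mathcal D_G\to\mathcal B_G$ that sends $y_i-1$ to $e^{x_i}-1$ for $i=0,\dots,n$, where $e^{x}=\sum_{k\ge0}x^k/k!$. -/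

import Mathlib

open scoped Graph

namespace Graph

section Combinatorics

variable {V E : Type*}

/-- The number `D_I` of edges of `G` joining a vertex in `I` to a vertex outside `I`. -/
noncomputable def cutSize (G : Graph V E) (I : Finset V) : ℕ :=
  {e : E | ∃ i ∈ I, ∃ j ∉ I, G.IsLink e i j}.ncard

/-- `G` has no cycles. A cycle of length `k + 1` consists of distinct vertices `v 0, …, v k` and
distinct edges `e 0, …, e k` such that `e i` joins `v i` to `v (i + 1)`, the index `i + 1` being
taken cyclically (addition in `Fin (k + 1)`). In particular a loop is a cycle of length one, and
two parallel edges form a cycle of length two. -/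
def IsAcyclic (G : Graph V E) : Prop :=
  ¬ ∃ (k : ℕ) (v : Fin (k + 1) → V) (e : Fin (k + 1) → E),
    Function.Injective v ∧ Function.Injective e ∧ ∀ i, G.IsLink (e i) (v i) (v (i + 1))

/-- The spanning forests of `G`: the subgraphs without cycles that contain all vertices of `G`. -/
def spanningForests (G : Graph V E) : Set (Graph V E) :=
  {F | F ≤s G ∧ F.IsAcyclic}

end Combinatorics

section Algebras

variable (K : Type*) [Field K] {E : Type*} {n : ℕ} (G : Graph (Fin (n + 1)) E)

/-- The algebra `Φ_G`: generated by commuting variables `φ_e`, one for each edge `e` of `G`,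
with the relations `φ_e ^ 2 = 0`. -/
abbrev Phi : Type _ :=
  MvPolynomial E(G) K ⧸
    Ideal.span (Set.range fun e : E(G) => (MvPolynomial.X e : MvPolynomial E(G) K) ^ 2)

/-- The generator `φ_e` of `Φ_G`. -/
noncomputable def phi (e : E(G)) : Phi K G :=
  Ideal.Quotient.mk _ (MvPolynomial.X e)

open Classical in
/-- The coefficient `c_{i,e}`: it is `1` if `e` joins `i` to some `j > i`, it is `-1` if `e` joins
`i` to some `j < i`, and it is `0` if `e` is not incident to `i`. -/
noncomputable def coeff (i : Fin (n + 1)) (e : E(G)) : K :=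
  if ∃ j, i < j ∧ G.IsLink (e : E) i j then 1
  else if ∃ j, j < i ∧ G.IsLink (e : E) i j then -1
  else 0

/-- `X_i = ∑_e c_{i,e} φ_e`. -/
noncomputable def XElem [Fintype E(G)] (i : Fin (n + 1)) : Phi K G :=
  ∑ e : E(G), coeff K G i e • phi K G e

/-- `Y_i = ∏_e (1 + c_{i,e} φ_e)`. -/
noncomputable def YElem [Fintype E(G)] (i : Fin (n + 1)) : Phi K G :=
  ∏ e : E(G), (1 + coeff K G i e • phi K G e)

/-- The algebra `C_G`: the subalgebra of `Φ_G` generated by `X_1, …, X_n`. -/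
noncomputable def CAlg [Fintype E(G)] : Subalgebra K (Phi K G) :=
  Algebra.adjoin K (Set.range fun i : Fin n => XElem K G i.succ)

/-- The algebra `K_G`: the subalgebra of `Φ_G` generated by `Y_0, …, Y_n`. -/
noncomputable def KAlg [Fintype E(G)] : Subalgebra K (Phi K G) :=
  Algebra.adjoin K (Set.range fun i : Fin (n + 1) => YElem K G i)

/-- The ideal of `K[x_1, …, x_n]` generated by the powers `p_I = (∑_{i ∈ I} x_i) ^ (D_I + 1)`, for
all nonempty `I ⊆ {1, …, n}`. The variable `x_i` has index `i - 1` in `Fin n`, so that `j : Fin n`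
stands for the vertex `j.succ`. -/
noncomputable def powerIdeal : Ideal (MvPolynomial (Fin n) K) :=
  Ideal.span {p | ∃ I : Finset (Fin n), I.Nonempty ∧
    p = (∑ i ∈ I, MvPolynomial.X i) ^ (G.cutSize (I.map (Fin.succEmb n)) + 1)}

/-- The algebra `B_G`. -/
abbrev BAlg : Type _ := MvPolynomial (Fin n) K ⧸ powerIdeal K G

/-- The elements `x_0, …, x_n` of `B_G`: for `i ≥ 1` the class of the variable `x_i`, and
`x_0 = -(x_1 + ⋯ + x_n)`. -/
noncomputable def xElem : Fin (n + 1) → BAlg K G :=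
  Fin.cons (-∑ i : Fin n, Ideal.Quotient.mk (powerIdeal K G) (MvPolynomial.X i))
    fun i : Fin n => Ideal.Quotient.mk (powerIdeal K G) (MvPolynomial.X i)

/-- The ideal of `K[y_0, …, y_n]` generated by `q_I = (∏_{i ∈ I} y_i - 1) ^ (D_I + 1)`, for all
nonempty `I ⊆ {0, …, n}`. -/
noncomputable def multIdeal : Ideal (MvPolynomial (Fin (n + 1)) K) :=
  Ideal.span {q | ∃ I : Finset (Fin (n + 1)), I.Nonempty ∧
    q = ((∏ i ∈ I, MvPolynomial.X i) - 1) ^ (G.cutSize I + 1)}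

/-- The algebra `D_G`. -/
abbrev DAlg : Type _ := MvPolynomial (Fin (n + 1)) K ⧸ multIdeal K G

/-- The class of the variable `y_i` in `D_G`. -/
noncomputable def yElem (i : Fin (n + 1)) : DAlg K G :=
  Ideal.Quotient.mk (multIdeal K G) (MvPolynomial.X i)

end Algebras

end Graph

/-! The core is the evaluation `x_i ↦ X_i` from polynomials to `Φ_G`: its image is `C_G`, and its
kernel turns out to be the power ideal, so `B_G ≅ C_G`. The proof is by deletion and contraction of
edges. Since `φ_e² = 0`, adding an edge `e` to an edge set `S` is a truncated Taylor expansion,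
`ev_{S+e}(p) = ev_S(p) + φ_e · ev_S(∂_e p)` (`evalEdges_insert`), where `∂_e` differentiates along
the difference of the ends of `e`. Thus `ev_{S+e}` kills `p` iff `ev_S` kills both `p` and `∂_e p`.

Contraction is encoded by a ring `𝓘` of vertex sets: the polynomial ring is replaced by the algebra
generated by the sums `x_I`, `I ∈ 𝓘`, and contracting `e` keeps the `I` that do not separate its
ends. Two facts drive the induction: a member of this algebra killed by `∂_e` lies in the algebra of
the contraction (`mem_contract_of_edgeDeriv_eq_zero`), and, if `𝓘` separates `e`, the image under
`∂_e` of the power ideal for `S+e` covers the one for `S` (`exists_edgeDeriv_eq_of_mem_powerSpan`).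
They give the kernel (`IsSquareFree.mem_powerSpan`) and the recursion `dim(S+e, 𝓘) = dim(S, 𝓘) +
dim(S, 𝓘/e)`. Forests obey the same recursion once acyclicity reads: each edge is the only one
crossing some cut.

For nilpotent `a` in characteristic zero, `exp a - 1` is `a` times a unit, and `a` and `exp a` are
polynomials in each other. Hence `C_G = K_G`, and the defining relations of `B_G` and `D_G`
correspond under exponentials and logarithms. -/

namespace IsNilpotent

/-! ### Exponentials and logarithms of nilpotent elements -/

section Exp

variable {A : Type*} [CommRing A]

/-- The tail `z` is kept polynomial in `a`, so that it stays in every subalgebra containing `a`. -/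
theorem exp_eq_one_add (K : Type*) [Field K] [CharZero K] [Algebra K A] [Module ℚ A] {a : A}
    (ha : IsNilpotent a) :
    ∃ z ∈ Algebra.adjoin K {a}, exp a = 1 + a + a ^ 2 * z := by
  obtain ⟨N, hN⟩ := ha
  have h : a ^ (N + 2) = 0 := by rw [pow_add, hN, zero_mul]
  refine ⟨∑ i ∈ Finset.range N, ((i + 2).factorial : ℚ)⁻¹ • a ^ i, ?_, ?_⟩
  · refine Subalgebra.sum_mem _ fun i _ => ?_
    rw [← Rat.cast_smul_eq_qsmul K]
    exact Subalgebra.smul_mem _ (Subalgebra.pow_mem _ (Algebra.self_mem_adjoin_singleton K a) _) _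
  · rw [exp_eq_sum h, Finset.sum_range_succ', Finset.sum_range_succ', Finset.mul_sum]
    have : ∀ i, ((i + 2).factorial : ℚ)⁻¹ • a ^ (i + 2)
        = a ^ 2 * (((i + 2).factorial : ℚ)⁻¹ • a ^ i) := fun i => by
      rw [← Rat.cast_smul_eq_qsmul K, ← Rat.cast_smul_eq_qsmul K, mul_smul_comm, ← pow_add,
        add_comm i 2]
    simp only [add_assoc, Nat.reduceAdd, this]
    simp only [Nat.factorial_one, Nat.factorial_zero, Nat.cast_one, inv_one, one_smul,
      pow_one, pow_zero]
    abel

/-- Because of the unit, a power of `exp a - 1` vanishes exactly when the same power of `a` does;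
this matches the relations of `B_G` and `D_G`. -/
theorem exp_sub_one_eq_mul_unit (K : Type*) [Field K] [CharZero K] [Algebra K A] [Module ℚ A]
    {a : A} (ha : IsNilpotent a) : ∃ u : A, IsUnit u ∧ exp a - 1 = a * u := by
  obtain ⟨z, -, hz⟩ := exp_eq_one_add K ha
  exact ⟨1 + a * z, ((Commute.all a z).isNilpotent_mul_right ha).isUnit_one_add, by rw [hz]; ring⟩

theorem exp_injective (K : Type*) [Field K] [CharZero K] [Algebra K A] [Module ℚ A]
    {a b : A} (ha : IsNilpotent a) (hb : IsNilpotent b) (h : exp a = exp b) : a = b := by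
  have hab : IsNilpotent (a - b) := (Commute.all a b).isNilpotent_sub ha hb
  obtain ⟨u, hu, h1⟩ := exp_sub_one_eq_mul_unit K hab
  have h2 : exp (a - b) = 1 := by
    rw [sub_eq_add_neg, exp_add_of_commute (Commute.all _ _) ha hb.neg, h, exp_mul_exp_neg_self hb]
  rw [h2, sub_self, eq_comm, hu.mul_left_eq_zero] at h1
  exact sub_eq_zero.mp h1

/-- With `u = exp a - 1 = a (1 + a z)`, the power `a ^ k` agrees with `u ^ k` modulo `a ^ (k + 1)
K[a]`. Descending induction on `k` then puts each `a ^ k K[a]` inside `K[exp a]`, without a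
logarithm series. -/
theorem mem_adjoin_exp (K : Type*) [Field K] [CharZero K] [Algebra K A] [Module ℚ A]
    {a : A} (ha : IsNilpotent a) : a ∈ Algebra.adjoin K {exp a} := by
  obtain ⟨z, hz, h⟩ := exp_eq_one_add K ha
  set S := Algebra.adjoin K {exp a}
  have hu : exp a - 1 ∈ S := sub_mem (Algebra.self_mem_adjoin_singleton K _) (one_mem _)
  obtain ⟨N, hN⟩ := ha
  have key : ∀ d k, k + d = N → ∀ q ∈ Algebra.adjoin K {a}, a ^ k * q ∈ S := by
    intro d
    induction d with
    | zero => rintro k rfl q -; rw [← Nat.add_zero k, hN, zero_mul]; exact zero_mem _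
    | succ d ih =>
      intro k hk q hq
      have hpow : a ^ k ∈ S := by
        have hgm : ∃ w ∈ Algebra.adjoin K {a}, (1 + a * z) ^ k = 1 + a * w := by
          clear * - hz
          induction k with
          | zero => exact ⟨0, zero_mem _, by simp⟩
          | succ k ih =>
            obtain ⟨w, hw, e⟩ := ih
            have ham := Algebra.self_mem_adjoin_singleton K a
            exact ⟨w + z + a * w * z, add_mem (add_mem hw hz) (mul_mem (mul_mem ham hw) hz),
              by rw [_root_.pow_succ, e]; ring⟩
        obtain ⟨w, hw, e⟩ := hgm
        have : a ^ k = (exp a - 1) ^ k - a ^ (k + 1) * w := by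
          rw [show exp a - 1 = a * (1 + a * z) by rw [h]; ring, mul_pow, e]; ring
        rw [this]
        exact sub_mem (pow_mem hu _) (ih (k + 1) (by omega) w hw)
      have hq' : ∃ c : K, ∃ w ∈ Algebra.adjoin K {a}, q = algebraMap K A c + a * w := by
        have ham := Algebra.self_mem_adjoin_singleton K a
        induction hq using Algebra.adjoin_induction with
        | mem x hx => exact ⟨0, 1, one_mem _, by rw [Set.mem_singleton_iff.mp hx]; simp⟩
        | algebraMap c => exact ⟨c, 0, zero_mem _, by simp⟩
        | add x y _ _ hx hy =>
          obtain ⟨c, w, hw, rfl⟩ := hx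
          obtain ⟨c', w', hw', rfl⟩ := hy
          exact ⟨c + c', w + w', add_mem hw hw', by rw [map_add]; ring⟩
        | mul x y _ _ hx hy =>
          obtain ⟨c, w, hw, rfl⟩ := hx
          obtain ⟨c', w', hw', rfl⟩ := hy
          refine ⟨c * c', c • w' + c' • w + a * w * w', add_mem (add_mem
            (Subalgebra.smul_mem _ hw' _) (Subalgebra.smul_mem _ hw _))
            (mul_mem (mul_mem ham hw) hw'), ?_⟩
          simp only [Algebra.smul_def, map_mul]; ring
      obtain ⟨c, w, hw, rfl⟩ := hq'
      rw [mul_add, ← mul_assoc, ← _root_.pow_succ]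
      exact add_mem (mul_mem hpow (Subalgebra.algebraMap_mem _ _)) (ih (k + 1) (by omega) w hw)
  -- If `N = 0` then `1 = 0` in `A`; otherwise take `k = 1` and `q = 1`.
  rcases N with _ | N
  · rw [show a = a ^ 0 * a by simp, hN, zero_mul]; exact zero_mem _
  · simpa using key N 1 (by omega) 1 (one_mem _)

/-- Successive approximation: subtracting the error `u ^ (k + 1) * w` from `l` multiplies that error
by `1 - y = -u`, up to terms divisible by its square, so the order in the nilpotent `u` rises by at
least one. -/
theorem exists_exp_eq (K : Type*) [Field K] [CharZero K] [Algebra K A] [Module ℚ A]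
    {y : A} (hy : IsNilpotent (y - 1)) : ∃ l : A, IsNilpotent l ∧ exp l = y := by
  set u := y - 1 with hu
  have key : ∀ k, ∃ l w : A, IsNilpotent l ∧ exp l = y + u ^ (k + 1) * w := by
    intro k
    induction k with
    | zero => exact ⟨0, -1, IsNilpotent.zero, by rw [exp_zero, hu]; ring⟩
    | succ k ih =>
      obtain ⟨l, w, hl, h⟩ := ih
      have hn : IsNilpotent (-(u ^ (k + 1) * w)) := by
        rw [_root_.pow_succ, mul_assoc, mul_left_comm]
        exact ((Commute.all _ _).isNilpotent_mul_right hy).neg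
      obtain ⟨z, -, hz⟩ := exp_eq_one_add K hn
      refine ⟨l + -(u ^ (k + 1) * w), -w + u ^ k * (-w ^ 2 + w ^ 2 * z * (y + u ^ (k + 1) * w)),
        (Commute.all _ _).isNilpotent_add hl hn, ?_⟩
      rw [exp_add_of_commute (Commute.all _ _) hl hn, h, hz, show y = 1 + u by rw [hu]; ring]
      ring
  obtain ⟨N, hN⟩ := hy
  obtain ⟨l, w, hl, h⟩ := key N
  exact ⟨l, hl, by rw [h, _root_.pow_succ, hN]; ring⟩

theorem isNilpotent_finsetSum {ι : Type*} {s : Finset ι} {f : ι → A}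
    (hf : ∀ i ∈ s, IsNilpotent (f i)) : IsNilpotent (∑ i ∈ s, f i) := by
  simp only [← mem_nilradical] at hf ⊢
  exact Ideal.sum_mem _ hf

theorem exp_sum [Module ℚ A] {ι : Type*} {s : Finset ι} {f : ι → A}
    (hf : ∀ i ∈ s, IsNilpotent (f i)) : exp (∑ i ∈ s, f i) = ∏ i ∈ s, exp (f i) := by
  classical
  induction s using Finset.induction_on with
  | empty => simp
  | insert i s hi ih =>
    have hs := fun j hj => hf j (Finset.mem_insert_of_mem hj)
    rw [Finset.sum_insert hi, Finset.prod_insert hi, exp_add_of_commute (Commute.all _ _)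
      (hf i (Finset.mem_insert_self _ _)) (isNilpotent_finsetSum hs), ih hs]

theorem exp_eq_of_sq_eq_zero [Module ℚ A] {a : A} (ha : a ^ 2 = 0) : exp a = 1 + a := by
  rw [exp_eq_sum ha]
  simp [Finset.sum_range_succ]

end Exp

end IsNilpotent

/-! ### A first-order equation for a locally nilpotent derivation -/

section LocallyNilpotent

variable {A : Type*} [CommRing A]

/-- The equation `m r + x D r = q` is solvable for a derivation `D` nilpotent on `q`. -/
theorem exists_nsmul_add_mul_derivation_eq {K : Type*} [Field K] [CharZero K] [Algebra K A]
    (D : Derivation K A A) {R : Subalgebra K A} {x : A} (hx : x ∈ R) (hDx : D x = 1)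
    (N : ℕ) : ∀ q ∈ R, D^[N] q = 0 → (∀ p ∈ R, D p ∈ R) → ∀ m : ℕ, ∃ r ∈ R,
      ((m + 1 : ℕ) : K) • r + x * D r = q := by
  induction N with
  | zero => intro q _ h _ m; exact ⟨0, zero_mem _, by simpa using h.symm⟩
  | succ N ih =>
    intro q hq hN hD m
    -- Differentiating the equation shows that the derivative of its solution must solve the
    -- equation for `D q` with `m + 1` in place of `m`. Take such an `r` from the induction and
    -- solve the original equation algebraically with `r` for the derivative.
    obtain ⟨r, hr, h⟩ := ih (D q) (hD q hq) (by rwa [← Function.iterate_succ_apply]) hD (m + 1)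
    have hm : ((m + 1 : ℕ) : K) ≠ 0 := Nat.cast_ne_zero.mpr (Nat.succ_ne_zero m)
    refine ⟨((m + 1 : ℕ) : K)⁻¹ • (q - x * r),
      Subalgebra.smul_mem _ (sub_mem hq (mul_mem hx hr)) _, ?_⟩
    rw [smul_smul, mul_inv_cancel₀ hm, one_smul, D.map_smul, map_sub, D.leibniz, hDx, ← h,
      mul_smul_comm]
    have e : (((m + 1 + 1 : ℕ) : K) • r + x * D r - (x • D r + r • (1 : A)))
        = ((m + 1 : ℕ) : K) • r := by
      rw [Nat.cast_succ (m + 1), add_smul, one_smul, smul_eq_mul, smul_eq_mul, mul_one]; ring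
    rw [e, mul_smul_comm, smul_smul, inv_mul_cancel₀ hm, one_smul]; ring

end LocallyNilpotent

/-! ### Constant-coefficient derivations and translations -/

namespace MvPolynomial

section ConstDerivation

variable {K : Type*} [Field K] {σ : Type*}

/-- The derivation with constant coefficients `c`. -/
noncomputable def constDerivation (c : σ → K) :
    Derivation K (MvPolynomial σ K) (MvPolynomial σ K) :=
  mkDerivation K fun i => C (c i)

@[simp]
theorem constDerivation_X (c : σ → K) (i : σ) : constDerivation c (X i) = C (c i) :=
  mkDerivation_X _ _ _

/-- The translation `x_i ↦ x_i + c_i t`. -/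
noncomputable def translation (c : σ → K) : MvPolynomial σ K →ₐ[K] Polynomial (MvPolynomial σ K) :=
  aeval fun i => Polynomial.C (X i) + Polynomial.C (C (c i)) * Polynomial.X

/-- The chain rule along the line `x + t c`; it reduces questions about `constDerivation` to
one-variable polynomials in `t`. -/
theorem derivative_translation (c : σ → K) (p : MvPolynomial σ K) :
    Polynomial.derivative (translation c p) = translation c (constDerivation c p) := by
  induction p using MvPolynomial.induction_on with
  | C a =>
    rw [← algebraMap_eq, AlgHom.commutes, Derivation.map_algebraMap, map_zero,
      IsScalarTower.algebraMap_apply K (MvPolynomial σ K), Polynomial.algebraMap_eq,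
      Polynomial.derivative_C]
  | add p q hp hq => simp [hp, hq]
  | mul_X p i hp =>
    have hC : translation c (C (c i)) = Polynomial.C (C (c i)) := by
      rw [← algebraMap_eq, AlgHom.commutes, IsScalarTower.algebraMap_apply K (MvPolynomial σ K),
        Polynomial.algebraMap_eq]
    have hX : translation c (X i) = Polynomial.C (X i) + Polynomial.C (C (c i)) * Polynomial.X :=
      aeval_X _ _
    rw [map_mul, Polynomial.derivative_mul, hp, Derivation.leibniz, constDerivation_X, map_add,
      smul_eq_mul, smul_eq_mul, map_mul, map_mul, hC, hX]
    simp
    ring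

theorem eval_translation (c : σ → K) (p x : MvPolynomial σ K) :
    (translation c p).eval x = aeval (fun i => X i + C (c i) * x) p := by
  have h : ((Polynomial.aeval (R := MvPolynomial σ K) x).restrictScalars K).comp
      (translation c) = aeval (fun i => X i + C (c i) * x) := by
    ext i; simp [translation]
  rw [← h]
  simp

theorem eval_zero_translation (c : σ → K) (p : MvPolynomial σ K) :
    (translation c p).eval 0 = p := by
  simp [eval_translation]

theorem exists_iterate_constDerivation_eq_zero (c : σ → K) (p : MvPolynomial σ K) :
    ∃ N, (constDerivation c)^[N] p = 0 := by
  refine ⟨(translation c p).natDegree + 1, ?_⟩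
  have h : ∀ N, Polynomial.derivative^[N] (translation c p)
      = translation c ((constDerivation c)^[N] p) := by
    intro N
    induction N with
    | zero => rfl
    | succ N ih =>
      rw [Function.iterate_succ_apply', ih, derivative_translation, Function.iterate_succ_apply']
  rw [← eval_zero_translation c ((constDerivation c)^[_] p), ← h,
    Polynomial.iterate_derivative_eq_zero (Nat.lt_succ_self _), Polynomial.eval_zero]

/-- In characteristic zero the translate has zero `t`-derivative only if it is constant in `t`, so
any polynomial may be substituted for `t`. -/
theorem aeval_eq_self_of_constDerivation_eq_zero [CharZero K] (c : σ → K)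
    {p : MvPolynomial σ K} (hp : constDerivation c p = 0) (x : MvPolynomial σ K) :
    aeval (fun i => X i + C (c i) * x) p = p := by
  have h : Polynomial.derivative (translation c p) = 0 := by
    rw [derivative_translation, hp, map_zero]
  have h1 := Polynomial.eq_C_of_natDegree_eq_zero (Polynomial.derivative_eq_zero.mp h)
  have h3 := eval_zero_translation c p
  rw [← eval_translation, h1, Polynomial.eval_C]
  rwa [h1, Polynomial.eval_C] at h3

end ConstDerivation

end MvPolynomial

/-! ### Rings of vertex sets and the derivative along an edge -/

namespace CutAlgebra

open MvPolynomial

variable {n : ℕ}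

/-- The set `I` of non-root vertices contains exactly one of the two ends of `ε`. -/
def Separates (ε : Fin (n + 1) × Fin (n + 1)) (I : Finset (Fin n)) : Prop :=
  ¬ (ε.1 ∈ I.map (Fin.succEmb n) ↔ ε.2 ∈ I.map (Fin.succEmb n))

instance (ε : Fin (n + 1) × Fin (n + 1)) : DecidablePred (Separates ε) := fun I => by
  unfold Separates; infer_instance

/-- A family of finite sets closed under union and difference. -/
structure IsFinsetRing (𝓘 : Set (Finset (Fin n))) : Prop where
  empty_mem : ∅ ∈ 𝓘
  union_mem : ∀ I ∈ 𝓘, ∀ J ∈ 𝓘, I ∪ J ∈ 𝓘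
  sdiff_mem : ∀ I ∈ 𝓘, ∀ J ∈ 𝓘, I \ J ∈ 𝓘

theorem IsFinsetRing.inter_mem {𝓘 : Set (Finset (Fin n))} (h : IsFinsetRing 𝓘) {I J} (hI : I ∈ 𝓘)
    (hJ : J ∈ 𝓘) : I ∩ J ∈ 𝓘 := by
  rw [← Finset.sdiff_sdiff_self_left]
  exact h.sdiff_mem _ hI _ (h.sdiff_mem _ hI _ hJ)

/-- The members of a family that do not separate the ends of `ε`. -/
def contract (𝓘 : Set (Finset (Fin n))) (ε : Fin (n + 1) × Fin (n + 1)) :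
    Set (Finset (Fin n)) :=
  {I ∈ 𝓘 | ¬ Separates ε I}

theorem contract_subset (𝓘 : Set (Finset (Fin n))) (ε : Fin (n + 1) × Fin (n + 1)) :
    contract 𝓘 ε ⊆ 𝓘 := fun _ h => h.1

theorem contract_eq_self {𝓘 : Set (Finset (Fin n))} {ε : Fin (n + 1) × Fin (n + 1)}
    (h : ∀ I ∈ 𝓘, ¬ Separates ε I) : contract 𝓘 ε = 𝓘 :=
  Set.Subset.antisymm (contract_subset _ _) fun I hI => ⟨hI, h I hI⟩

/-- This closure under contraction is why the induction runs over rings of sets. -/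
theorem IsFinsetRing.contract {𝓘 : Set (Finset (Fin n))} (h : IsFinsetRing 𝓘)
    (ε : Fin (n + 1) × Fin (n + 1)) : IsFinsetRing (contract 𝓘 ε) where
  empty_mem := ⟨h.empty_mem, by simp [Separates]⟩
  union_mem I hI J hJ := ⟨h.union_mem _ hI.1 _ hJ.1, by
    have h1 := hI.2
    have h2 := hJ.2
    simp only [Separates, Finset.map_union, Finset.mem_union] at *
    tauto⟩
  sdiff_mem I hI J hJ := ⟨h.sdiff_mem _ hI.1 _ hJ.1, by
    have h1 := hI.2
    have h2 := hJ.2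
    simp only [Separates, Finset.map_sdiff, Finset.mem_sdiff] at *
    tauto⟩

section Derivation

variable (K : Type*) [Field K]

/-- The linear form `∑_{i ∈ I} x_i`. -/
noncomputable def setSum (I : Finset (Fin n)) : MvPolynomial (Fin n) K := ∑ i ∈ I, X i

/-- The coordinates of the difference of the two ends of `ε`. -/
def edgeCoeff (ε : Fin (n + 1) × Fin (n + 1)) (i : Fin n) : K :=
  (if i.succ = ε.1 then 1 else 0) - (if i.succ = ε.2 then 1 else 0)

/-- The difference of the indicator function of `I` at the two ends of `ε`. -/
def edgeSign (ε : Fin (n + 1) × Fin (n + 1)) (I : Finset (Fin n)) : K :=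
  (if ε.1 ∈ I.map (Fin.succEmb n) then 1 else 0) - (if ε.2 ∈ I.map (Fin.succEmb n) then 1 else 0)

theorem sum_edgeCoeff (ε : Fin (n + 1) × Fin (n + 1)) (I : Finset (Fin n)) :
    ∑ i ∈ I, edgeCoeff K ε i = edgeSign K ε I := by
  have h : ∀ v : Fin (n + 1), ∑ i ∈ I, (if i.succ = v then (1 : K) else 0)
      = if v ∈ I.map (Fin.succEmb n) then 1 else 0 := by
    intro v
    exact (Finset.sum_map I (Fin.succEmb n) (fun w => if w = v then (1 : K) else 0)).symm.trans
      (Finset.sum_ite_eq' _ _ _)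
  simp only [edgeCoeff, edgeSign, Finset.sum_sub_distrib, h]

theorem edgeSign_eq_zero {ε : Fin (n + 1) × Fin (n + 1)} {I : Finset (Fin n)}
    (h : ¬ Separates ε I) : edgeSign K ε I = 0 := by
  rw [Separates, not_not] at h
  simp only [edgeSign, h, sub_self]

theorem edgeSign_eq_one_or {ε : Fin (n + 1) × Fin (n + 1)} {I : Finset (Fin n)}
    (h : Separates ε I) :
    (ε.1 ∈ I.map (Fin.succEmb n) ∧ ε.2 ∉ I.map (Fin.succEmb n) ∧ edgeSign K ε I = 1) ∨
    (ε.1 ∉ I.map (Fin.succEmb n) ∧ ε.2 ∈ I.map (Fin.succEmb n) ∧ edgeSign K ε I = -1) := by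
  unfold edgeSign
  unfold Separates at h
  split_ifs with h1 h2 h2 <;> simp_all

theorem edgeSign_mul_self {ε : Fin (n + 1) × Fin (n + 1)} {I : Finset (Fin n)}
    (h : Separates ε I) : edgeSign K ε I * edgeSign K ε I = 1 := by
  rcases edgeSign_eq_one_or K h with h | h <;> simp [h.2.2]

/-- The derivative along an edge. -/
noncomputable def edgeDeriv (ε : Fin (n + 1) × Fin (n + 1)) :
    Derivation K (MvPolynomial (Fin n) K) (MvPolynomial (Fin n) K) :=
  constDerivation (edgeCoeff K ε)

theorem edgeDeriv_setSum (ε : Fin (n + 1) × Fin (n + 1)) (I : Finset (Fin n)) :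
    edgeDeriv K ε (setSum K I) = C (edgeSign K ε I) := by
  simp [edgeDeriv, setSum, ← sum_edgeCoeff]

/-- The subalgebra generated by the linear forms of the sets in a family. -/
noncomputable def familyAlg (𝓘 : Set (Finset (Fin n))) : Subalgebra K (MvPolynomial (Fin n) K) :=
  Algebra.adjoin K (setSum K '' 𝓘)

variable {K}

theorem setSum_mem {𝓘 : Set (Finset (Fin n))} {I} (hI : I ∈ 𝓘) : setSum K I ∈ familyAlg K 𝓘 :=
  Algebra.subset_adjoin ⟨I, hI, rfl⟩

theorem familyAlg_mono {𝓘 𝓙 : Set (Finset (Fin n))} (h : 𝓘 ⊆ 𝓙) :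
    familyAlg K 𝓘 ≤ familyAlg K 𝓙 :=
  Algebra.adjoin_mono (Set.image_mono h)

theorem edgeDeriv_mem (ε : Fin (n + 1) × Fin (n + 1)) (𝓘 : Set (Finset (Fin n))) :
    ∀ p ∈ familyAlg K 𝓘, edgeDeriv K ε p ∈ familyAlg K 𝓘 := by
  intro p hp
  induction hp using Algebra.adjoin_induction with
  | mem x hx =>
    obtain ⟨I, -, rfl⟩ := hx
    rw [edgeDeriv_setSum]
    exact Subalgebra.algebraMap_mem _ _
  | algebraMap c => rw [Derivation.map_algebraMap]; exact zero_mem _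
  | add x y _ _ hx hy => rw [map_add]; exact add_mem hx hy
  | mul x y hx' hy' hx hy =>
    rw [Derivation.leibniz]
    exact add_mem (mul_mem hx' hy) (mul_mem hy' hx)

theorem edgeDeriv_eq_zero {ε : Fin (n + 1) × Fin (n + 1)} {𝓘 : Set (Finset (Fin n))}
    (h : ∀ I ∈ 𝓘, ¬ Separates ε I) : ∀ p ∈ familyAlg K 𝓘, edgeDeriv K ε p = 0 := by
  intro p hp
  induction hp using Algebra.adjoin_induction with
  | mem x hx =>
    obtain ⟨I, hI, rfl⟩ := hx
    rw [edgeDeriv_setSum, edgeSign_eq_zero K (h I hI), C_0]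
  | algebraMap c => rw [Derivation.map_algebraMap]
  | add x y _ _ hx hy => rw [map_add, hx, hy, add_zero]
  | mul x y hx' hy' hx hy => rw [Derivation.leibniz, hx, hy, smul_zero, smul_zero, add_zero]

theorem setSum_sdiff_add_inter (I J : Finset (Fin n)) :
    setSum K (I \ J) + setSum K (I ∩ J) = setSum K I := by
  rw [add_comm]; exact Finset.sum_inter_add_sum_sdiff I J _

/-- If `I` and `J` contain the same end of `ε`, use `x_I - x_J = x_{I \ J} - x_{J \ I}`; if opposite
ends, use `x_I + x_J = x_{I ∪ J} + x_{I ∩ J}`. In each case the sets on the right do not separate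
`ε`. -/
theorem setSum_sub_mem {ε : Fin (n + 1) × Fin (n + 1)} {𝓘 : Set (Finset (Fin n))}
    (h𝓘 : IsFinsetRing 𝓘) {I J} (hI : I ∈ 𝓘) (hJ : J ∈ 𝓘) (hsJ : Separates ε J) :
    setSum K I - C (edgeSign K ε I * edgeSign K ε J) * setSum K J ∈
      familyAlg K (contract 𝓘 ε) := by
  by_cases hsI : Separates ε I
  swap
  · rw [edgeSign_eq_zero K hsI, zero_mul, C_0, zero_mul, sub_zero]
    exact setSum_mem ⟨hI, hsI⟩
  have same : (ε.1 ∈ I.map (Fin.succEmb n) ↔ ε.1 ∈ J.map (Fin.succEmb n)) →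
      setSum K I - setSum K J ∈ familyAlg K (contract 𝓘 ε) := by
    intro h
    rw [← setSum_sdiff_add_inter I J, ← setSum_sdiff_add_inter J I, Finset.inter_comm J I,
      add_sub_add_right_eq_sub]
    refine sub_mem (setSum_mem ⟨h𝓘.sdiff_mem _ hI _ hJ, ?_⟩)
      (setSum_mem ⟨h𝓘.sdiff_mem _ hJ _ hI, ?_⟩) <;>
    · simp only [Separates, Finset.map_sdiff, Finset.mem_sdiff] at *
      tauto
  have opp : ¬ (ε.1 ∈ I.map (Fin.succEmb n) ↔ ε.1 ∈ J.map (Fin.succEmb n)) →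
      setSum K I + setSum K J ∈ familyAlg K (contract 𝓘 ε) := by
    intro h
    have e : setSum K I + setSum K J = setSum K (I ∪ J) + setSum K (I ∩ J) :=
      (Finset.sum_union_inter ..).symm
    rw [e]
    refine add_mem (setSum_mem ⟨h𝓘.union_mem _ hI _ hJ, ?_⟩)
      (setSum_mem ⟨h𝓘.inter_mem hI hJ, ?_⟩)
    · simp only [Separates, Finset.map_union, Finset.mem_union] at *
      tauto
    · simp only [Separates, Finset.map_inter, Finset.mem_inter] at *
      tauto
  rcases edgeSign_eq_one_or K hsI with h1 | h1 <;> rcases edgeSign_eq_one_or K hsJ with h2 | h2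
  · simpa [h1, h2] using same (by tauto)
  · simpa [h1, h2] using opp (by tauto)
  · simpa [h1, h2] using opp (by tauto)
  · simpa [h1, h2] using same (by tauto)

/-- The constants of the derivative along an edge, in the subalgebra of a family. -/
theorem mem_contract_of_edgeDeriv_eq_zero [CharZero K] {ε : Fin (n + 1) × Fin (n + 1)}
    {𝓘 : Set (Finset (Fin n))} (h𝓘 : IsFinsetRing 𝓘) {p : MvPolynomial (Fin n) K}
    (hp : p ∈ familyAlg K 𝓘) (hDp : edgeDeriv K ε p = 0) :
    p ∈ familyAlg K (contract 𝓘 ε) := by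
  by_cases h : ∀ I ∈ 𝓘, ¬ Separates ε I
  · rwa [contract_eq_self h]
  push Not at h
  obtain ⟨J, hJ, hsJ⟩ := h
  -- This value of `t` makes the translation kill `x_J` and send each `x_I` to the combination in
  -- `setSum_sub_mem`: it projects the algebra of `𝓘` into that of the contraction while fixing `p`.
  rw [← aeval_eq_self_of_constDerivation_eq_zero _ hDp (-C (edgeSign K ε J) * setSum K J)]
  clear hDp
  induction hp using Algebra.adjoin_induction with
  | mem x hx =>
    obtain ⟨I, hI, rfl⟩ := hx
    convert setSum_sub_mem (K := K) h𝓘 hI hJ hsJ using 1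
    nth_rw 2 [setSum]
    simp only [map_sum, aeval_X]
    rw [Finset.sum_add_distrib, ← Finset.sum_mul, ← map_sum, sum_edgeCoeff, C_mul, ← setSum]
    ring
  | algebraMap c => rw [AlgHom.commutes]; exact Subalgebra.algebraMap_mem _ _
  | add x y _ _ hx hy => rw [map_add]; exact add_mem hx hy
  | mul x y hx' hy' hx hy => rw [map_mul]; exact mul_mem hx hy

end Derivation

end CutAlgebra

/-! ### Power ideals and integration along an edge -/

namespace CutAlgebra

open MvPolynomial

section Ideal

variable {n : ℕ} {K : Type*} [Field K] {ι : Type*} (ends : ι → Fin (n + 1) × Fin (n + 1))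

/-- The number of edges in `S` separated by `I`. -/
def cutCount (S : Finset ι) (I : Finset (Fin n)) : ℕ :=
  (S.filter fun e => Separates (ends e) I).card

theorem cutCount_insert_of_separates [DecidableEq ι] {S : Finset ι} {e : ι} (he : e ∉ S)
    {I : Finset (Fin n)} (h : Separates (ends e) I) :
    cutCount ends (insert e S) I = cutCount ends S I + 1 := by
  rw [cutCount, Finset.filter_insert, if_pos h, Finset.card_insert_of_notMem (by simp [he]),
    cutCount]

theorem cutCount_insert_of_not_separates [DecidableEq ι] {S : Finset ι} {e : ι}
    {I : Finset (Fin n)} (h : ¬ Separates (ends e) I) :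
    cutCount ends (insert e S) I = cutCount ends S I := by
  rw [cutCount, Finset.filter_insert, if_neg h, cutCount]

variable (K) in
/-- The ideal, in the subalgebra of a family, of the powers of its linear forms. -/
noncomputable def powerSpan (S : Finset ι) (𝓘 : Set (Finset (Fin n))) :
    Submodule K (MvPolynomial (Fin n) K) :=
  Submodule.span K {p | ∃ I ∈ 𝓘, ∃ q ∈ familyAlg K 𝓘, p = q * setSum K I ^ (cutCount ends S I + 1)}

variable {ends}

theorem mul_pow_mem_powerSpan {S : Finset ι} {𝓘 : Set (Finset (Fin n))} {I} (hI : I ∈ 𝓘)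
    {q : MvPolynomial (Fin n) K} (hq : q ∈ familyAlg K 𝓘) :
    q * setSum K I ^ (cutCount ends S I + 1) ∈ powerSpan K ends S 𝓘 :=
  Submodule.subset_span ⟨I, hI, q, hq, rfl⟩

theorem powerSpan_le_familyAlg (S : Finset ι) (𝓘 : Set (Finset (Fin n))) :
    powerSpan K ends S 𝓘 ≤ (familyAlg K 𝓘).toSubmodule := by
  rw [powerSpan, Submodule.span_le]
  rintro _ ⟨I, hI, q, hq, rfl⟩
  exact (familyAlg K 𝓘).mul_mem hq (pow_mem (setSum_mem hI) _)

theorem mul_mem_powerSpan {S : Finset ι} {𝓘 : Set (Finset (Fin n))}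
    {p q : MvPolynomial (Fin n) K} (hp : p ∈ familyAlg K 𝓘) (hq : q ∈ powerSpan K ends S 𝓘) :
    p * q ∈ powerSpan K ends S 𝓘 := by
  induction hq using Submodule.span_induction with
  | zero => rw [mul_zero]; exact zero_mem _
  | add x y _ _ hx hy => rw [mul_add]; exact add_mem hx hy
  | smul c x _ hx => rw [mul_smul_comm]; exact Submodule.smul_mem _ _ hx
  | mem x hx =>
    obtain ⟨I, hI, r, hr, rfl⟩ := hx
    rw [← mul_assoc]
    exact mul_pow_mem_powerSpan hI (mul_mem hp hr)

/-- Without edges all exponents are one, so only constants survive modulo the span. -/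
theorem exists_sub_C_mem_powerSpan_empty {𝓘 : Set (Finset (Fin n))} {p : MvPolynomial (Fin n) K}
    (hp : p ∈ familyAlg K 𝓘) : ∃ c : K, p - C c ∈ powerSpan K ends ∅ 𝓘 := by
  induction hp using Algebra.adjoin_induction with
  | mem x hx =>
    obtain ⟨I, hI, rfl⟩ := hx
    refine ⟨0, ?_⟩
    simpa [cutCount] using mul_pow_mem_powerSpan (ends := ends) (S := ∅) hI
      (one_mem (familyAlg K 𝓘))
  | algebraMap c => exact ⟨c, by rw [algebraMap_eq, sub_self]; exact zero_mem _⟩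
  | add x y _ _ hx hy =>
    obtain ⟨c, hc⟩ := hx
    obtain ⟨d, hd⟩ := hy
    refine ⟨c + d, ?_⟩
    rw [C_add, add_sub_add_comm]
    exact add_mem hc hd
  | mul x y hx' hy' hx hy =>
    obtain ⟨c, hc⟩ := hx
    obtain ⟨d, hd⟩ := hy
    refine ⟨c * d, ?_⟩
    have e : x * y - C (c * d) = x * (y - C d) + d • (x - C c) := by
      rw [smul_eq_C_mul, C_mul]; ring
    rw [e]
    exact add_mem (mul_mem_powerSpan hx' hd) (Submodule.smul_mem _ _ hc)

theorem powerSpan_insert_of_not_separates [DecidableEq ι] (S : Finset ι) {e : ι}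
    {𝓘 : Set (Finset (Fin n))} (h : ∀ I ∈ 𝓘, ¬ Separates (ends e) I) :
    powerSpan K ends (insert e S) 𝓘 = powerSpan K ends S 𝓘 := by
  have : ∀ I ∈ 𝓘, cutCount ends (insert e S) I = cutCount ends S I :=
    fun I hI => cutCount_insert_of_not_separates ends (h I hI)
  unfold powerSpan
  congr 1
  ext p
  constructor <;> rintro ⟨I, hI, q, hq, rfl⟩
  · exact ⟨I, hI, q, hq, by rw [this I hI]⟩
  · exact ⟨I, hI, q, hq, by rw [this I hI]⟩

theorem powerSpan_contract_le [DecidableEq ι] (S : Finset ι) (e : ι)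
    (𝓘 : Set (Finset (Fin n))) :
    powerSpan K ends S (contract 𝓘 (ends e)) ≤ powerSpan K ends (insert e S) 𝓘 := by
  rw [powerSpan, Submodule.span_le]
  rintro _ ⟨I, hI, q, hq, rfl⟩
  rw [← cutCount_insert_of_not_separates ends hI.2]
  exact mul_pow_mem_powerSpan hI.1 (familyAlg_mono (contract_subset _ _) hq)

variable [CharZero K]

theorem exists_nsmul_add_mul_edgeDeriv_eq {ε : Fin (n + 1) × Fin (n + 1)}
    {𝓘 : Set (Finset (Fin n))} {I} (hI : I ∈ 𝓘) (hsI : Separates ε I)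
    {q : MvPolynomial (Fin n) K} (hq : q ∈ familyAlg K 𝓘) (m : ℕ) :
    ∃ r ∈ familyAlg K 𝓘, ((m + 1 : ℕ) : K) • r
      + (edgeSign K ε I • setSum K I) * edgeDeriv K ε r = q := by
  obtain ⟨N, hN⟩ := exists_iterate_constDerivation_eq_zero (edgeCoeff K ε) q
  refine exists_nsmul_add_mul_derivation_eq (edgeDeriv K ε)
    (Subalgebra.smul_mem _ (setSum_mem hI) _) ?_ N q hq hN (edgeDeriv_mem ε 𝓘) m
  rw [Derivation.map_smul, edgeDeriv_setSum, smul_eq_C_mul, ← C_mul, edgeSign_mul_self K hsI, C_1]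

/-- If `s = ±1` is the sign of `I` and `r + s x_I ∂r = q`, then `s x_I r` is an antiderivative of
`q`. -/
theorem exists_edgeDeriv_eq {ε : Fin (n + 1) × Fin (n + 1)}
    {𝓘 : Set (Finset (Fin n))} {I} (hI : I ∈ 𝓘) (hsI : Separates ε I)
    {q : MvPolynomial (Fin n) K} (hq : q ∈ familyAlg K 𝓘) :
    ∃ r ∈ familyAlg K 𝓘, edgeDeriv K ε r = q := by
  obtain ⟨r, hr, h⟩ := exists_nsmul_add_mul_edgeDeriv_eq (K := K) hI hsI hq 0
  refine ⟨(edgeSign K ε I • setSum K I) * r,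
    mul_mem (Subalgebra.smul_mem _ (setSum_mem hI) _) hr, ?_⟩
  rw [← h, Derivation.leibniz, Derivation.map_smul, edgeDeriv_setSum,
    smul_eq_C_mul (C _), ← C_mul, edgeSign_mul_self K hsI]
  simp [add_comm]

/-- Take a generator `q x_I ^ (d + 1)`. If `I` separates `e`, inserting `e` raises the exponent to
`d + 2`, and `s r x_I ^ (d + 2)` has derivative `((d + 2) r + s x_I ∂r) x_I ^ (d + 1)`, so the
solvable equation `(d + 2) r + s x_I ∂r = q` is what is needed. If not, `x_I` is constant along `e`,
the exponent is unchanged, and integrating `q` with the help of `J` suffices. -/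
theorem exists_edgeDeriv_eq_of_mem_powerSpan [DecidableEq ι] {S : Finset ι} {e : ι} (he : e ∉ S)
    {𝓘 : Set (Finset (Fin n))} {J} (hJ : J ∈ 𝓘) (hsJ : Separates (ends e) J)
    {p : MvPolynomial (Fin n) K} (hp : p ∈ powerSpan K ends S 𝓘) :
    ∃ r ∈ powerSpan K ends (insert e S) 𝓘, edgeDeriv K (ends e) r = p := by
  induction hp using Submodule.span_induction with
  | zero => exact ⟨0, zero_mem _, map_zero _⟩
  | add x y _ _ hx hy =>
    obtain ⟨r, hr, rfl⟩ := hx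
    obtain ⟨s, hs, rfl⟩ := hy
    exact ⟨r + s, add_mem hr hs, map_add _ _ _⟩
  | smul c x _ hx =>
    obtain ⟨r, hr, rfl⟩ := hx
    exact ⟨c • r, Submodule.smul_mem _ _ hr, Derivation.map_smul _ _ _⟩
  | mem x hx =>
    obtain ⟨I, hI, q, hq, rfl⟩ := hx
    by_cases hsI : Separates (ends e) I
    · obtain ⟨r, hr, h⟩ := exists_nsmul_add_mul_edgeDeriv_eq (K := K) hI hsI hq
        (cutCount ends S I + 1)
      have hs := edgeSign_mul_self K hsI
      set s := edgeSign K (ends e) I with hsdef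
      refine ⟨(s • r) * setSum K I ^ (cutCount ends (insert e S) I + 1),
        mul_pow_mem_powerSpan hI (Subalgebra.smul_mem _ hr _), ?_⟩
      rw [cutCount_insert_of_separates ends he hsI, ← h, Derivation.leibniz, Derivation.map_smul,
        Derivation.leibniz_pow, edgeDeriv_setSum, ← hsdef]
      simp only [smul_eq_C_mul, smul_eq_mul, nsmul_eq_mul, Nat.add_sub_cancel, map_natCast]
      have hs' : (C s * C s : MvPolynomial (Fin n) K) = 1 := by rw [← C_mul, hs, C_1]
      linear_combination (((cutCount ends S I + 1 + 1 : ℕ) : MvPolynomial (Fin n) K) * r *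
        setSum K I ^ (cutCount ends S I + 1)) * hs'
    · obtain ⟨r, hr, rfl⟩ := exists_edgeDeriv_eq (K := K) hJ hsJ hq
      refine ⟨r * setSum K I ^ (cutCount ends (insert e S) I + 1), mul_pow_mem_powerSpan hI hr, ?_⟩
      rw [cutCount_insert_of_not_separates ends hsI, Derivation.leibniz, Derivation.leibniz_pow,
        edgeDeriv_setSum, edgeSign_eq_zero K hsI]
      simp [mul_comm]

end Ideal

/-! ### Evaluation at square-zero elements: kernel and dimension recursion -/

section Evaluation

variable {n : ℕ} {K : Type*} [Field K] {ι : Type*} (ends : ι → Fin (n + 1) × Fin (n + 1))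
  {A : Type*} [CommRing A] [Algebra K A] (φ : ι → A)

variable (K) in
/-- The homomorphism `x_i ↦ ∑_{e ∈ S} c_{i,e} φ_e`. -/
noncomputable def evalEdges (S : Finset ι) : MvPolynomial (Fin n) K →ₐ[K] A :=
  aeval fun i => ∑ e ∈ S, edgeCoeff K (ends e) i • φ e

/-- The Taylor expansion in `φ e`, cut off after the linear term. -/
theorem evalEdges_insert [DecidableEq ι] {S : Finset ι} {e : ι} (he : e ∉ S) (hφ : φ e ^ 2 = 0)
    (p : MvPolynomial (Fin n) K) :
    evalEdges K ends φ (insert e S) p =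
      evalEdges K ends φ S p + φ e * evalEdges K ends φ S (edgeDeriv K (ends e) p) := by
  induction p using MvPolynomial.induction_on with
  | C a => rw [← algebraMap_eq, AlgHom.commutes, AlgHom.commutes, Derivation.map_algebraMap]; simp
  | add p q hp hq => rw [map_add, hp, hq]; simp only [map_add]; ring
  | mul_X p i hp =>
    have h1 : ∀ T, evalEdges K ends φ T (X i) = ∑ e ∈ T, edgeCoeff K (ends e) i • φ e :=
      fun T => aeval_X _ _
    have h2 : edgeDeriv K (ends e) (X i) = C (edgeCoeff K (ends e) i) := constDerivation_X _ _
    rw [map_mul, hp, Derivation.leibniz, h2, smul_eq_mul, smul_eq_mul]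
    simp only [map_mul, map_add]
    rw [h1, h1, Finset.sum_insert he, ← algebraMap_eq, AlgHom.commutes, Algebra.smul_def]
    linear_combination (algebraMap K A (edgeCoeff K (ends e) i) *
      evalEdges K ends φ S (edgeDeriv K (ends e) p)) * hφ

theorem evalEdges_setSum (S : Finset ι) (I : Finset (Fin n)) :
    evalEdges K ends φ S (setSum K I) =
      ∑ e ∈ S.filter fun e => Separates (ends e) I, edgeSign K (ends e) I • φ e := by
  rw [Finset.sum_filter_of_ne]
  · simp only [setSum, map_sum, evalEdges, aeval_X]
    rw [Finset.sum_comm]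
    simp only [← Finset.sum_smul, sum_edgeCoeff]
  · intro e _ h
    by_contra hs
    exact h (by rw [edgeSign_eq_zero K hs, zero_smul])

theorem sum_pow_card_succ_eq_zero {φ : ι → A} (T : Finset ι) (hφ : ∀ e ∈ T, φ e ^ 2 = 0) :
    (∑ e ∈ T, φ e) ^ (T.card + 1) = 0 := by
  classical
  induction T using Finset.induction_on with
  | empty => simp
  | insert e T he ih =>
    rw [Finset.sum_insert he, Finset.card_insert_of_notMem he]
    exact (Commute.all _ _).add_pow_eq_zero_of_add_le_succ_of_pow_eq_zero
      (hφ e (Finset.mem_insert_self _ _)) (ih fun f hf => hφ f (Finset.mem_insert_of_mem hf))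
      (by omega)

variable {ends φ}

theorem evalEdges_setSum_pow (hφ : ∀ e, φ e ^ 2 = 0) (S : Finset ι) (I : Finset (Fin n)) :
    evalEdges K ends φ S (setSum K I) ^ (cutCount ends S I + 1) = 0 := by
  rw [evalEdges_setSum]
  exact sum_pow_card_succ_eq_zero _ fun e _ => by rw [smul_pow, hφ, smul_zero]

theorem evalEdges_eq_zero_of_mem_powerSpan (hφ : ∀ e, φ e ^ 2 = 0) {S : Finset ι}
    {𝓘 : Set (Finset (Fin n))} {p : MvPolynomial (Fin n) K} (hp : p ∈ powerSpan K ends S 𝓘) :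
    evalEdges K ends φ S p = 0 := by
  have : powerSpan K ends S 𝓘 ≤ LinearMap.ker (evalEdges K ends φ S).toLinearMap := by
    rw [powerSpan, Submodule.span_le]
    rintro _ ⟨I, hI, q, hq, rfl⟩
    simp [evalEdges_setSum_pow hφ]
  exact this hp

/-- The elements `φ_e` are square-zero and independent. -/
structure IsSquareFree (φ : ι → A) : Prop where
  sq_eq_zero : ∀ e, φ e ^ 2 = 0
  exists_hom : ∀ e, ∃ τ : A →ₐ[K] DualNumber A, τ (φ e) = DualNumber.eps ∧
    ∀ f, f ≠ e → τ (φ f) = TrivSqZeroExt.inl (φ f)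

/-- Replacing `φ e` by the dual number `ε` makes the coefficients of `φ e` and of `1` linear
functions (`g` and `h`) of the evaluated element, so the two Taylor terms can be read off
separately. -/
theorem IsSquareFree.exists_linearMap [DecidableEq ι] (hφ : IsSquareFree (K := K) φ) (e : ι) :
    ∃ g h : A →ₗ[K] A, ∀ (S : Finset ι), e ∉ S → ∀ p : MvPolynomial (Fin n) K,
      g (evalEdges K ends φ (insert e S) p) = evalEdges K ends φ S (edgeDeriv K (ends e) p) ∧
      h (evalEdges K ends φ (insert e S) p) = evalEdges K ends φ S p := by
  obtain ⟨τ, h1, h2⟩ := hφ.exists_hom e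
  refine ⟨(TrivSqZeroExt.sndHom A A).restrictScalars K ∘ₗ τ.toLinearMap,
    (TrivSqZeroExt.fstHom K A A).toLinearMap ∘ₗ τ.toLinearMap, fun S he p => ?_⟩
  have h3 : τ.comp (evalEdges K ends φ S) =
      (TrivSqZeroExt.inlAlgHom K A A).comp (evalEdges K ends φ S) := by
    ext1 i
    simp only [AlgHom.comp_apply, evalEdges, aeval_X, map_sum, map_smul]
    refine Finset.sum_congr rfl fun f hf => ?_
    rw [h2 f (ne_of_mem_of_not_mem hf he)]
    rfl
  have h4 : ∀ q, τ (evalEdges K ends φ S q) = TrivSqZeroExt.inl (evalEdges K ends φ S q) :=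
    fun q => DFunLike.congr_fun h3 q
  have h5 := congrArg τ (evalEdges_insert ends φ he (hφ.sq_eq_zero e) p)
  rw [map_add, map_mul, h1, h4, h4] at h5
  constructor
  · simp [h5]
  · simp [h5]

theorem evalEdges_insert_of_edgeDeriv_eq_zero [DecidableEq ι] (hφ : ∀ e, φ e ^ 2 = 0)
    {S : Finset ι} {e : ι} (he : e ∉ S) {p : MvPolynomial (Fin n) K}
    (hp : edgeDeriv K (ends e) p = 0) :
    evalEdges K ends φ (insert e S) p = evalEdges K ends φ S p := by
  rw [evalEdges_insert ends φ he (hφ e), hp, map_zero, mul_zero, add_zero]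

variable [CharZero K]

/-- By induction `∂_e p` lies in the power ideal for `S`; lift it to `r` in the one for `S + e`. The
difference `p - r` is killed by `∂_e`, hence lives on the contraction, where the induction applies
to it with the edge set `S`. -/
theorem IsSquareFree.mem_powerSpan (hφ : IsSquareFree (K := K) φ) [Nontrivial A] (S : Finset ι) :
    ∀ {𝓘 : Set (Finset (Fin n))}, IsFinsetRing 𝓘 → ∀ {p : MvPolynomial (Fin n) K},
      p ∈ familyAlg K 𝓘 → evalEdges K ends φ S p = 0 → p ∈ powerSpan K ends S 𝓘 := by
  classical
  induction S using Finset.induction_on with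
  | empty =>
    intro 𝓘 _ p hp h0
    obtain ⟨c, hc⟩ := exists_sub_C_mem_powerSpan_empty (ends := ends) hp
    have h := evalEdges_eq_zero_of_mem_powerSpan hφ.sq_eq_zero hc
    rw [map_sub, h0, zero_sub, neg_eq_zero, ← algebraMap_eq, AlgHom.commutes,
      map_eq_zero_iff _ (algebraMap K A).injective] at h
    rwa [h, C_0, sub_zero] at hc
  | insert e S he ih =>
    intro 𝓘 h𝓘 p hp h0
    by_cases hs : ∀ I ∈ 𝓘, ¬ Separates (ends e) I
    · rw [powerSpan_insert_of_not_separates S hs]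
      rw [evalEdges_insert_of_edgeDeriv_eq_zero hφ.sq_eq_zero he (edgeDeriv_eq_zero hs p hp)] at h0
      exact ih h𝓘 hp h0
    push Not at hs
    obtain ⟨J, hJ, hsJ⟩ := hs
    obtain ⟨g, h, hgh⟩ := hφ.exists_linearMap (ends := ends) e
    have h1 : evalEdges K ends φ S (edgeDeriv K (ends e) p) = 0 := by
      rw [← (hgh S he p).1, h0, map_zero]
    obtain ⟨r, hr, hrp⟩ := exists_edgeDeriv_eq_of_mem_powerSpan he hJ hsJ
      (ih h𝓘 (edgeDeriv_mem _ 𝓘 p hp) h1)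
    have h2 : p - r ∈ familyAlg K (contract 𝓘 (ends e)) :=
      mem_contract_of_edgeDeriv_eq_zero h𝓘 (sub_mem hp (powerSpan_le_familyAlg _ _ hr))
        (by rw [map_sub, hrp, sub_self])
    have h3 : evalEdges K ends φ S (p - r) = 0 := by
      rw [← (hgh S he _).2, map_sub, h0, evalEdges_eq_zero_of_mem_powerSpan hφ.sq_eq_zero hr,
        sub_zero, map_zero]
    rw [← sub_add_cancel p r]
    exact add_mem (powerSpan_contract_le S e 𝓘 (ih (h𝓘.contract _) h2 h3)) hr

/-- Rank–nullity for the `φ e`-coefficient on the image: its range is the deletion because `∂_e` is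
onto, its kernel is the contraction. -/
theorem IsSquareFree.finrank_insert [DecidableEq ι] (hφ : IsSquareFree (K := K) φ) [Nontrivial A]
    [Module.Finite K A] {S : Finset ι} {e : ι} (he : e ∉ S) {𝓘 : Set (Finset (Fin n))}
    (h𝓘 : IsFinsetRing 𝓘) {J} (hJ : J ∈ 𝓘) (hsJ : Separates (ends e) J) :
    Module.finrank K ((familyAlg K 𝓘).toSubmodule.map
        (evalEdges K ends φ (insert e S)).toLinearMap) =
      Module.finrank K ((familyAlg K 𝓘).toSubmodule.map (evalEdges K ends φ S).toLinearMap) +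
      Module.finrank K ((familyAlg K (contract 𝓘 (ends e))).toSubmodule.map
        (evalEdges K ends φ S).toLinearMap) := by
  obtain ⟨g, h, hgh⟩ := hφ.exists_linearMap (ends := ends) e
  set W := (familyAlg K 𝓘).toSubmodule.map (evalEdges K ends φ (insert e S)).toLinearMap
  have h1 : LinearMap.range (g.domRestrict W) =
      (familyAlg K 𝓘).toSubmodule.map (evalEdges K ends φ S).toLinearMap := by
    rw [LinearMap.range_domRestrict]
    ext y
    constructor
    · rintro ⟨_, ⟨p, hp, rfl⟩, rfl⟩
      exact ⟨edgeDeriv K (ends e) p, edgeDeriv_mem _ _ p hp, (hgh S he p).1.symm⟩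
    · rintro ⟨p, hp, rfl⟩
      obtain ⟨r, hr, rfl⟩ := exists_edgeDeriv_eq (K := K) hJ hsJ hp
      exact ⟨_, ⟨r, hr, rfl⟩, (hgh S he r).1⟩
  have h2 : (LinearMap.ker (g.domRestrict W)).map W.subtype =
      (familyAlg K (contract 𝓘 (ends e))).toSubmodule.map (evalEdges K ends φ S).toLinearMap := by
    ext y
    constructor
    · rintro ⟨⟨_, ⟨p, hp, rfl⟩⟩, hk, rfl⟩
      have h0 : evalEdges K ends φ S (edgeDeriv K (ends e) p) = 0 := by
        rw [← (hgh S he p).1]; exact hk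
      -- Subtracting `r` leaves the evaluation on `insert e S` unchanged and makes the derivative
      -- zero.
      obtain ⟨r, hr, hrp⟩ := exists_edgeDeriv_eq_of_mem_powerSpan he hJ hsJ
        (hφ.mem_powerSpan S h𝓘 (edgeDeriv_mem _ 𝓘 p hp) h0)
      have hD : edgeDeriv K (ends e) (p - r) = 0 := by rw [map_sub, hrp, sub_self]
      refine ⟨p - r, mem_contract_of_edgeDeriv_eq_zero h𝓘
        (sub_mem hp (powerSpan_le_familyAlg _ _ hr)) hD, ?_⟩
      change evalEdges K ends φ S (p - r) = evalEdges K ends φ (insert e S) p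
      rw [← evalEdges_insert_of_edgeDeriv_eq_zero hφ.sq_eq_zero he hD, map_sub,
        evalEdges_eq_zero_of_mem_powerSpan hφ.sq_eq_zero hr, sub_zero]
    · rintro ⟨p, hp, rfl⟩
      have hD : edgeDeriv K (ends e) p = 0 := edgeDeriv_eq_zero (fun I hI => hI.2) p hp
      have hins := evalEdges_insert_of_edgeDeriv_eq_zero hφ.sq_eq_zero he hD
      refine ⟨⟨evalEdges K ends φ S p, p, familyAlg_mono (contract_subset _ _) hp, hins⟩, ?_, rfl⟩
      change g (evalEdges K ends φ S p) = 0
      rw [← hins, (hgh S he p).1, hD, map_zero]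
  rw [← LinearMap.finrank_range_add_finrank_ker (g.domRestrict W), h1, ← h2,
    LinearEquiv.finrank_eq (Submodule.equivMapOfInjective W.subtype W.injective_subtype _)]

end Evaluation

/-! ### Counting independent edge sets by deletion and contraction -/

section Count

variable {n : ℕ} {K : Type*} [Field K] {ι : Type*} {ends : ι → Fin (n + 1) × Fin (n + 1)}

/-- Every edge of `F` is the only edge of `F` separated by some member of the family. -/
def IsIndep (ends : ι → Fin (n + 1) × Fin (n + 1)) (𝓘 : Set (Finset (Fin n))) (F : Finset ι) :
    Prop :=
  ∀ e ∈ F, ∃ I ∈ 𝓘, Separates (ends e) I ∧ ∀ f ∈ F, f ≠ e → ¬ Separates (ends f) I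

/-- Separation is additive modulo two. -/
theorem separates_symmDiff (ε : Fin (n + 1) × Fin (n + 1)) (I J : Finset (Fin n)) :
    Separates ε ((I \ J) ∪ (J \ I)) ↔ ¬ (Separates ε I ↔ Separates ε J) := by
  simp only [Separates, Finset.map_union, Finset.map_sdiff, Finset.mem_union, Finset.mem_sdiff]
  by_cases h1 : ε.1 ∈ I.map (Fin.succEmb n) <;> by_cases h2 : ε.2 ∈ I.map (Fin.succEmb n) <;>
    by_cases h3 : ε.1 ∈ J.map (Fin.succEmb n) <;> by_cases h4 : ε.2 ∈ J.map (Fin.succEmb n) <;>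
    simp only [h1, h2, h3, h4] <;> decide

/-- Start from `J` and remove the edges of `F'` from its cut one at a time, by symmetric difference
with a cut that meets `F` only in the edge to be removed. These cuts come from the contraction, so
`e` stays separated. -/
theorem exists_separates_only [DecidableEq ι] {𝓘 : Set (Finset (Fin n))} (h𝓘 : IsFinsetRing 𝓘)
    {F : Finset ι} {e : ι} {J} (hJ : J ∈ 𝓘) (hsJ : Separates (ends e) J)
    (hF : IsIndep ends (contract 𝓘 (ends e)) F) :
    ∀ F' ⊆ F, ∃ I ∈ 𝓘, Separates (ends e) I ∧ ∀ f ∈ F', ¬ Separates (ends f) I := by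
  intro F'
  induction F' using Finset.induction_on with
  | empty => exact fun _ => ⟨J, hJ, hsJ, by simp⟩
  | insert f F' hf ih =>
    intro hsub
    obtain ⟨I, hI, hsI, h⟩ := ih ((Finset.subset_insert _ _).trans hsub)
    by_cases hfI : Separates (ends f) I
    swap
    · exact ⟨I, hI, hsI, by simpa [hfI] using h⟩
    obtain ⟨I', hI', hsI', h'⟩ := hF f (hsub (Finset.mem_insert_self _ _))
    refine ⟨(I \ I') ∪ (I' \ I), h𝓘.union_mem _ (h𝓘.sdiff_mem _ hI _ hI'.1) _
      (h𝓘.sdiff_mem _ hI'.1 _ hI), ?_, ?_⟩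
    · rw [separates_symmDiff]
      exact fun h => hI'.2 (h.mp hsI)
    · intro k hk
      rw [separates_symmDiff, not_not]
      rcases Finset.mem_insert.mp hk with rfl | hk
      · exact iff_of_true hfI hsI'
      · exact iff_of_false (h k hk)
          (h' k (hsub (Finset.mem_insert_of_mem hk)) (ne_of_mem_of_not_mem hk hf))

theorem isIndep_insert_iff [DecidableEq ι] {𝓘 : Set (Finset (Fin n))} (h𝓘 : IsFinsetRing 𝓘)
    {F : Finset ι} {e : ι} (he : e ∉ F) :
    IsIndep ends 𝓘 (insert e F) ↔
      (∃ J ∈ 𝓘, Separates (ends e) J) ∧ IsIndep ends (contract 𝓘 (ends e)) F := by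
  constructor
  · intro h
    refine ⟨?_, fun f hf => ?_⟩
    · obtain ⟨J, hJ, hs, -⟩ := h e (Finset.mem_insert_self _ _)
      exact ⟨J, hJ, hs⟩
    · obtain ⟨I, hI, hs, h'⟩ := h f (Finset.mem_insert_of_mem hf)
      exact ⟨I, ⟨hI, h' e (Finset.mem_insert_self _ _) (ne_of_mem_of_not_mem hf he).symm⟩, hs,
        fun k hk => h' k (Finset.mem_insert_of_mem hk)⟩
  · rintro ⟨⟨J, hJ, hsJ⟩, h⟩ f hf
    rcases Finset.mem_insert.mp hf with rfl | hf
    · obtain ⟨I, hI, hsI, h'⟩ := exists_separates_only h𝓘 hJ hsJ h F subset_rfl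
      refine ⟨I, hI, hsI, fun k hk hkf => h' k ((Finset.mem_insert.mp hk).resolve_left hkf)⟩
    · obtain ⟨I, hI, hs, h'⟩ := h f hf
      refine ⟨I, hI.1, hs, fun k hk hkf => ?_⟩
      rcases Finset.mem_insert.mp hk with rfl | hk
      · exact hI.2
      · exact h' k hk hkf

open Classical in
theorem card_isIndep_insert {𝓘 : Set (Finset (Fin n))} (h𝓘 : IsFinsetRing 𝓘)
    {S : Finset ι} {e : ι} (he : e ∉ S) :
    ((insert e S).powerset.filter (IsIndep ends 𝓘)).card =
      (S.powerset.filter (IsIndep ends 𝓘)).card +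
      if ∃ J ∈ 𝓘, Separates (ends e) J then
        (S.powerset.filter (IsIndep ends (contract 𝓘 (ends e)))).card else 0 := by
  have hnot : ∀ F ∈ S.powerset, e ∉ F := fun F hF h => he (Finset.mem_powerset.mp hF h)
  have hinj : Set.InjOn (insert e) (S.powerset : Set (Finset ι)) := fun F hF F' hF' h => by
    rw [← Finset.erase_insert (hnot F hF), ← Finset.erase_insert (hnot F' hF'), h]
  rw [Finset.powerset_insert, Finset.filter_union, Finset.card_union_of_disjoint,
    Finset.filter_image, Finset.card_image_of_injOn (hinj.mono fun F hF =>
      (Finset.mem_filter.mp hF).1)]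
  · congr 1
    split_ifs with h
    · congr 1
      refine Finset.filter_congr fun F hF => ?_
      rw [isIndep_insert_iff h𝓘 (hnot F hF)]
      exact and_iff_right h
    · rw [Finset.card_eq_zero, Finset.filter_eq_empty_iff]
      intro F hF
      rw [isIndep_insert_iff h𝓘 (hnot F hF)]
      exact fun h' => h h'.1
  · refine Finset.disjoint_filter_filter (Finset.disjoint_left.mpr fun F hF hF' => ?_)
    obtain ⟨F', -, rfl⟩ := Finset.mem_image.mp hF'
    exact hnot _ hF (Finset.mem_insert_self _ _)

open Classical in
-- Both sides obey the same recursion, and both ignore an edge that no member of `𝓘` separates.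
theorem IsSquareFree.finrank_eq_card [CharZero K] {A : Type*} [CommRing A] [Algebra K A]
    {φ : ι → A} (hφ : IsSquareFree (K := K) φ) [Nontrivial A] [Module.Finite K A] (S : Finset ι) :
    ∀ {𝓘 : Set (Finset (Fin n))}, IsFinsetRing 𝓘 →
      Module.finrank K ((familyAlg K 𝓘).toSubmodule.map (evalEdges K ends φ S).toLinearMap) =
        (S.powerset.filter (IsIndep ends 𝓘)).card := by
  induction S using Finset.induction_on with
  | empty =>
    intro 𝓘 _
    have h1 : (familyAlg K 𝓘).toSubmodule.map (evalEdges K ends φ ∅).toLinearMap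
        = Submodule.span K {1} := by
      refine le_antisymm ?_ ?_
      · rintro _ ⟨p, hp, rfl⟩
        obtain ⟨c, hc⟩ := exists_sub_C_mem_powerSpan_empty (ends := ends) hp
        have h := evalEdges_eq_zero_of_mem_powerSpan hφ.sq_eq_zero hc
        rw [map_sub, sub_eq_zero, ← algebraMap_eq, AlgHom.commutes] at h
        rw [Submodule.mem_span_singleton]
        exact ⟨c, by rw [← Algebra.algebraMap_eq_smul_one]; exact h.symm⟩
      · rw [Submodule.span_singleton_le_iff_mem]
        exact ⟨1, one_mem (familyAlg K 𝓘), map_one (evalEdges K ends φ ∅)⟩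
    rw [h1, finrank_span_singleton one_ne_zero, Finset.powerset_empty, Finset.filter_singleton,
      if_pos (by simp [IsIndep]), Finset.card_singleton]
  | insert e S he ih =>
    intro 𝓘 h𝓘
    rw [card_isIndep_insert h𝓘 he]
    split_ifs with h
    · obtain ⟨J, hJ, hsJ⟩ := h
      rw [hφ.finrank_insert he h𝓘 hJ hsJ, ih h𝓘, ih (h𝓘.contract _)]
    · push Not at h
      rw [add_zero, ← ih h𝓘]
      have h1 : (familyAlg K 𝓘).toSubmodule.map (evalEdges K ends φ (insert e S)).toLinearMap =
          (familyAlg K 𝓘).toSubmodule.map (evalEdges K ends φ S).toLinearMap :=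
        SetLike.coe_injective <| Set.image_congr fun p hp => evalEdges_insert_of_edgeDeriv_eq_zero hφ.sq_eq_zero he
          (edgeDeriv_eq_zero h p hp)
      rw [h1]

end Count
end CutAlgebra

/-! ### Acyclicity in terms of cuts -/

namespace Graph

section Acyclic

variable {V E : Type*} {F : Graph V E}

/-- Let `U` be the component of `x` after removing `e`. If it contained `y`, a path from `x` to `y`
closed up by `e` would be a cycle. -/
theorem IsAcyclic.exists_cut (hF : F.IsAcyclic) {e : E} {x y : V} (he : F.IsLink e x y) :
    ∃ U : Set V, x ∈ U ∧ y ∉ U ∧ ∀ f u v, F.IsLink f u v → f ≠ e → (u ∈ U ↔ v ∈ U) := by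
  classical
  let H : SimpleGraph V :=
    { Adj := fun u v => u ≠ v ∧ ∃ f ≠ e, F.IsLink f u v
      symm := ⟨fun u v ⟨h, f, hf, hl⟩ => ⟨h.symm, f, hf, hl.symm⟩⟩
      loopless := ⟨fun u h => h.1 rfl⟩ }
  have step : ∀ f u v, F.IsLink f u v → f ≠ e → H.Reachable u v := by
    intro f u v hl hf
    by_cases huv : u = v
    · rw [huv]
    · exact SimpleGraph.Adj.reachable ⟨huv, f, hf, hl⟩
  refine ⟨{w | H.Reachable x w}, SimpleGraph.Reachable.refl x, fun hy => ?_, fun f u v hl hf =>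
    ⟨fun h => h.trans (step f u v hl hf), fun h => h.trans (step f u v hl hf).symm⟩⟩
  obtain ⟨p, hp⟩ := hy.exists_isPath
  -- The cyclic successor of the last index is `0`, so that slot takes the closing edge `e`.
  have key : ∀ i : Fin (p.length + 1), ∃ g, F.IsLink g (p.getVert i) (p.getVert (i + 1 : Fin _)) ∧
      (g = e ↔ i = Fin.last _) := by
    intro i
    induction i using Fin.lastCases with
    | last => exact ⟨e, by simpa using he.symm, by simp⟩
    | cast i =>
      obtain ⟨-, f, hf, hl⟩ := p.adj_getVert_succ i.2
      exact ⟨f, by simpa using hl, by simp [hf, (Fin.castSucc_lt_last i).ne]⟩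
  choose g hg hge using key
  have hv : Function.Injective fun i : Fin (p.length + 1) => p.getVert i := fun i j h =>
    Fin.ext (hp.getVert_injOn (by simp; omega) (by simp; omega) h)
  refine hF ⟨p.length, fun i => p.getVert i, g, hv, fun i j hij => ?_, hg⟩
  by_cases hi : i = Fin.last _
  · rw [hi, ((hge j).mp (hij ▸ (hge i).mpr hi))]
  by_cases hj : j = Fin.last _
  · exact absurd ((hge i).mp (hij.trans ((hge j).mpr hj))) hi
  -- Equal path edges at different positions would force both `i = j + 1` and `j = i + 1`.
  rcases (hg i).eq_and_eq_or_eq_and_eq (hij ▸ hg j) with h | h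
  · exact hv h.1
  · have h1 := congrArg Fin.val (hv h.1)
    have h2 := congrArg Fin.val (hv h.2)
    rw [Fin.val_add_one_of_lt (Fin.lt_last_iff_ne_last.mpr hj)] at h1
    rw [Fin.val_add_one_of_lt (Fin.lt_last_iff_ne_last.mpr hi)] at h2
    omega

/-- Around a cycle, leave `U` through `e 0`: no later edge crosses the cut, yet the walk returns to
`v 0 ∈ U`. -/
theorem isAcyclic_of_exists_cut (h : ∀ e x y, F.IsLink e x y →
    ∃ U : Set V, x ∈ U ∧ y ∉ U ∧ ∀ f u v, F.IsLink f u v → f ≠ e → (u ∈ U ↔ v ∈ U)) :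
    F.IsAcyclic := by
  rintro ⟨k, v, e, -, he, hl⟩
  obtain ⟨U, h0, h1, hU⟩ := h (e 0) _ _ (hl 0)
  have key : ∀ j : ℕ, j ≤ k → v (Fin.ofNat (k + 1) (j + 1)) ∉ U := by
    intro j
    induction j with
    | zero => intro _; convert h1 using 3; ext; simp
    | succ j ih =>
      intro hj
      have hne : Fin.ofNat (k + 1) (j + 1) ≠ 0 := by
        intro h
        have := congrArg Fin.val h
        rw [Fin.val_ofNat, Nat.mod_eq_of_lt (by omega)] at this
        simp at this
      have hsucc : Fin.ofNat (k + 1) (j + 1 + 1) = Fin.ofNat (k + 1) (j + 1) + 1 := by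
        ext; simp [Fin.val_add]
      rw [hsucc, ← hU _ _ _ (hl _) (he.ne hne)]
      exact ih (by omega)
  refine key k le_rfl ?_
  convert h0 using 2
  ext
  simp

theorem isAcyclic_iff_exists_cut : F.IsAcyclic ↔ ∀ e x y, F.IsLink e x y →
    ∃ U : Set V, x ∈ U ∧ y ∉ U ∧ ∀ f u v, F.IsLink f u v → f ≠ e → (u ∈ U ↔ v ∈ U) :=
  ⟨fun h _ _ _ he => h.exists_cut he, isAcyclic_of_exists_cut⟩

end Acyclic

/-! ### Oriented ends, cut sizes and spanning forests -/

section Ends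

open CutAlgebra

variable {E : Type*} {n : ℕ} {G : Graph (Fin (n + 1)) E}

theorem mem_map_succEmb_iff {I : Finset (Fin n)} {U : Set (Fin (n + 1))}
    (h : ∀ i, i ∈ I ↔ ¬ (i.succ ∈ U ↔ 0 ∈ U)) (v : Fin (n + 1)) :
    v ∈ I.map (Fin.succEmb n) ↔ ¬ (v ∈ U ↔ 0 ∈ U) := by
  cases v using Fin.cases with
  | zero => simp
  | succ i =>
    rw [← h, ← Fin.coe_succEmb, Finset.mem_map']

/-- Complementing `U` when it contains the root `0` does not change which pairs it separates. -/
theorem exists_separates_iff (U : Set (Fin (n + 1))) :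
    ∃ I : Finset (Fin n), ∀ ε, Separates ε I ↔ ¬ (ε.1 ∈ U ↔ ε.2 ∈ U) := by
  classical
  refine ⟨Finset.univ.filter fun i => ¬ (i.succ ∈ U ↔ 0 ∈ U), fun ε => ?_⟩
  rw [Separates, mem_map_succEmb_iff (U := U) (by simp), mem_map_succEmb_iff (U := U) (by simp)]
  tauto

variable (G) in
/-- `ends` lists the two ends of every edge, in increasing order. -/
def IsEnds (ends : E(G) → Fin (n + 1) × Fin (n + 1)) : Prop :=
  ∀ e, (ends e).1 < (ends e).2 ∧ G.IsLink e (ends e).1 (ends e).2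

variable (G) in
theorem exists_isEnds [G.Loopless] : ∃ ends, G.IsEnds ends := by
  have : ∀ e : E(G), ∃ ε : Fin (n + 1) × Fin (n + 1), ε.1 < ε.2 ∧ G.IsLink e ε.1 ε.2 := by
    intro e
    obtain ⟨x, y, h⟩ := G.exists_isLink_of_mem_edgeSet e.2
    rcases lt_or_gt_of_ne h.ne with hlt | hlt
    · exact ⟨(x, y), hlt, h⟩
    · exact ⟨(y, x), hlt, h.symm⟩
  choose ends h using this
  exact ⟨ends, h⟩

variable {ends : E(G) → Fin (n + 1) × Fin (n + 1)}

theorem IsEnds.isLink_iff (h : G.IsEnds ends) (e : E(G)) (x y : Fin (n + 1)) :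
    G.IsLink e x y ↔
      (ends e).1 = x ∧ (ends e).2 = y ∨ (ends e).1 = y ∧ (ends e).2 = x :=
  (h e).2.isLink_iff

theorem IsEnds.cutSize_eq [Fintype E(G)] (h : G.IsEnds ends) (I : Finset (Fin (n + 1))) :
    G.cutSize I = (Finset.univ.filter fun e => ¬ ((ends e).1 ∈ I ↔ (ends e).2 ∈ I)).card := by
  rw [cutSize, ← Set.ncard_coe_finset, ← Set.ncard_image_of_injective _ Subtype.val_injective]
  congr 1
  ext e
  simp only [Set.mem_ofPred_eq, Set.mem_image, Finset.coe_filter, Finset.mem_univ, true_and]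
  constructor
  · rintro ⟨i, hi, j, hj, hl⟩
    refine ⟨⟨e, hl.edge_mem⟩, ?_, rfl⟩
    rcases (h.isLink_iff ⟨e, hl.edge_mem⟩ i j).mp hl with ⟨h1, h2⟩ | ⟨h1, h2⟩ <;> simp [h1, h2, hi, hj]
  · rintro ⟨e, he, rfl⟩
    by_cases h1 : (ends e).1 ∈ I
    · exact ⟨_, h1, _, fun h2 => he (iff_of_true h1 h2), (h e).2⟩
    · exact ⟨_, by tauto, _, h1, (h e).2.symm⟩

theorem IsEnds.cutSize_map [Fintype E(G)] (h : G.IsEnds ends) (I : Finset (Fin n)) :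
    G.cutSize (I.map (Fin.succEmb n)) = cutCount ends Finset.univ I := by
  rw [h.cutSize_eq]
  rfl

theorem IsEnds.cutSize_compl [Fintype E(G)] (h : G.IsEnds ends) (I : Finset (Fin (n + 1))) :
    G.cutSize Iᶜ = G.cutSize I := by
  rw [h.cutSize_eq, h.cutSize_eq]
  congr 1
  refine Finset.filter_congr fun e _ => ?_
  simp only [Finset.mem_compl]
  tauto

theorem IsEnds.isAcyclic_restrict_iff (h : G.IsEnds ends) (F : Finset E(G)) :
    (G.restrict (Subtype.val '' (F : Set E(G)))).IsAcyclic ↔ IsIndep ends Set.univ F := by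
  rw [isAcyclic_iff_exists_cut]
  constructor
  · intro hF e he
    obtain ⟨U, h1, h2, hU⟩ := hF e _ _ ⟨⟨e, he, rfl⟩, (h e).2⟩
    obtain ⟨I, hI⟩ := exists_separates_iff U
    refine ⟨I, trivial, (hI _).mpr fun h => h2 (h.mp h1), fun f hf hfe => ?_⟩
    rw [hI, not_not]
    exact hU f _ _ ⟨⟨f, hf, rfl⟩, (h f).2⟩ (fun h => hfe (Subtype.ext h))
  · rintro hF _ x y ⟨⟨e, he, rfl⟩, hl⟩
    obtain ⟨I, -, hs, hI⟩ := hF e he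
    have hsep : ∀ (f : E(G)) (u v : Fin (n + 1)), G.IsLink f u v →
        (Separates (ends f) I ↔ ¬ (u ∈ I.map (Fin.succEmb n) ↔ v ∈ I.map (Fin.succEmb n))) := by
      intro f u v hl
      rcases (h.isLink_iff f u v).mp hl with ⟨h1, h2⟩ | ⟨h1, h2⟩
      · rw [Separates, h1, h2]
      · rw [Separates, h1, h2, iff_comm (a := v ∈ _)]
    rw [hsep e x y hl] at hs
    refine ⟨{w | w ∈ I.map (Fin.succEmb n) ↔ x ∈ I.map (Fin.succEmb n)}, Iff.rfl, fun h => hs h.symm,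
      ?_⟩
    rintro _ u v ⟨⟨f, hf, rfl⟩, hl'⟩ hfe
    have := hI f hf (fun h => hfe (congrArg _ h))
    rw [hsep f u v hl', not_not] at this
    exact iff_congr this Iff.rfl

open Classical in
-- A spanning subgraph is determined by its edge set.
theorem IsEnds.ncard_spanningForests [Fintype E(G)] (h : G.IsEnds ends) :
    G.spanningForests.ncard =
      ((Finset.univ : Finset E(G)).powerset.filter (IsIndep ends Set.univ)).card := by
  have hinj : Function.Injective fun F : Finset E(G) =>
      G.restrict (Subtype.val '' (F : Set E(G))) := by
    intro F F' hF
    ext e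
    have h1 := congrArg (fun H : Graph _ _ => (e : E) ∈ E(H)) hF
    simpa using h1
  rw [← Set.ncard_coe_finset, ← Set.ncard_image_of_injective _ hinj]
  congr 1
  ext H
  simp only [spanningForests, Set.mem_ofPred_eq, Set.mem_image, Finset.coe_filter,
    Finset.powerset_univ, Finset.mem_univ, true_and]
  constructor
  · rintro ⟨hH, hac⟩
    have e : G.restrict (Subtype.val '' ((Finset.univ.filter fun e : E(G) => (e : E) ∈ E(H)) :
        Set E(G))) = H := by
      refine (Compatible.of_le_le (G := G) restrict_le hH.le).ext ?_ ?_
      · exact hH.vertexSet_eq.symm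
      · ext f
        simp only [edgeSet_restrict, Set.mem_inter_iff, Set.mem_image]
        constructor
        · rintro ⟨-, f, hf, rfl⟩
          simpa using hf
        · intro hf
          have := hH.le.edgeSet_mono hf
          exact ⟨this, ⟨f, this⟩, by simpa using hf, rfl⟩
    refine ⟨_, ?_, e⟩
    rw [← h.isAcyclic_restrict_iff, e]
    exact hac
  · rintro ⟨F, hF, rfl⟩
    exact ⟨⟨restrict_le, rfl⟩, (h.isAcyclic_restrict_iff F).mpr hF⟩

end Ends

end Graph

namespace Graph

open CutAlgebra

/-! ### Universal property and finiteness of `Φ_G` -/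

section Phi

variable (K : Type*) [Field K] {E : Type*} {n : ℕ} (G : Graph (Fin (n + 1)) E)

theorem phi_sq (e : E(G)) : phi K G e ^ 2 = 0 := by
  rw [phi, ← map_pow, Ideal.Quotient.eq_zero_iff_mem]
  exact Ideal.subset_span ⟨e, rfl⟩

/-- A family of square-zero elements defines a homomorphism on `Φ_G`. -/
theorem exists_algHom_phi {A : Type*} [CommRing A] [Algebra K A] (a : E(G) → A)
    (ha : ∀ e, a e ^ 2 = 0) : ∃ τ : Phi K G →ₐ[K] A, ∀ e, τ (phi K G e) = a e := by
  refine ⟨Ideal.Quotient.liftₐ _ (MvPolynomial.aeval a) fun p hp => ?_, fun e => ?_⟩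
  · have : Ideal.span (Set.range fun e : E(G) => (MvPolynomial.X e : MvPolynomial E(G) K) ^ 2) ≤
        RingHom.ker (MvPolynomial.aeval (R := K) a) := by
      rw [Ideal.span_le]
      rintro _ ⟨e, rfl⟩
      simp [ha]
    exact this hp
  · exact MvPolynomial.aeval_X _ _

instance : Nontrivial (Phi K G) := by
  obtain ⟨τ, -⟩ := exists_algHom_phi K G (fun _ => (0 : K)) (by simp)
  exact τ.toRingHom.domain_nontrivial

theorem adjoin_phi : Algebra.adjoin K (Set.range (phi K G)) = ⊤ := by
  have h : Set.range (phi K G) = Ideal.Quotient.mkₐ K _ '' Set.range MvPolynomial.X := by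
    rw [← Set.range_comp]; rfl
  rw [h, ← AlgHom.map_adjoin, MvPolynomial.adjoin_range_X, Algebra.map_top, AlgHom.range_eq_top]
  exact Ideal.Quotient.mkₐ_surjective K _

instance [Fintype E(G)] : Module.Finite K (Phi K G) := by
  have := Algebra.finite_adjoin_of_finite_of_isIntegral (R := K) (Set.finite_range (phi K G)) (by
    rintro _ ⟨e, rfl⟩
    exact IsIntegral.of_pow (n := 2) (by norm_num) (by rw [phi_sq]; exact isIntegral_zero))
  rw [adjoin_phi] at this
  exact Module.Finite.equiv (Subalgebra.topEquiv (R := K) (A := Phi K G)).toLinearEquiv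

theorem isSquareFree_phi : IsSquareFree (K := K) (phi K G) where
  sq_eq_zero := phi_sq K G
  exists_hom e := by
    classical
    obtain ⟨τ, hτ⟩ := exists_algHom_phi K G (A := DualNumber (Phi K G))
      (fun f => if f = e then DualNumber.eps else TrivSqZeroExt.inl (phi K G f)) (fun f => by
        split_ifs
        · rw [pow_two, DualNumber.eps_mul_eps]
        · rw [TrivSqZeroExt.inl_pow, phi_sq, TrivSqZeroExt.inl_zero])
    exact ⟨τ, by simp [hτ], fun f hf => by simp [hτ, hf]⟩

end Phi

/-! ### The algebras `C_G` and `K_G`, and the presentation of `C_G` -/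

section Generators

variable {K : Type*} [Field K] {E : Type*} {n : ℕ} {G : Graph (Fin (n + 1)) E}
  {ends : E(G) → Fin (n + 1) × Fin (n + 1)}

theorem IsEnds.coeff_eq (h : G.IsEnds ends) (i : Fin (n + 1)) (e : E(G)) :
    coeff K G i e = (if i = (ends e).1 then 1 else 0) - (if i = (ends e).2 then 1 else 0) := by
  have hlt := (h e).1
  simp only [coeff, h.isLink_iff]
  by_cases h1 : i = (ends e).1
  · have h2 : i ≠ (ends e).2 := h1 ▸ hlt.ne
    rw [if_pos ⟨(ends e).2, h1 ▸ hlt, Or.inl ⟨h1.symm, rfl⟩⟩, if_pos h1, if_neg h2, sub_zero]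
  · have h3 : ¬ ∃ j, i < j ∧ ((ends e).1 = i ∧ (ends e).2 = j ∨ (ends e).1 = j ∧ (ends e).2 = i) := by
      rintro ⟨j, hj, ⟨h2, -⟩ | ⟨rfl, rfl⟩⟩
      · exact h1 h2.symm
      · exact lt_asymm hj hlt
    rw [if_neg h3, if_neg h1]
    by_cases h2 : i = (ends e).2
    · rw [if_pos ⟨(ends e).1, h2 ▸ hlt, Or.inr ⟨rfl, h2.symm⟩⟩, if_pos h2, zero_sub]
    · rw [if_neg, if_neg h2, sub_zero]
      rintro ⟨j, -, ⟨h4, -⟩ | ⟨-, h4⟩⟩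
      · exact h1 h4.symm
      · exact h2 h4.symm

theorem isNilpotent_smul_phi (c : K) (e : E(G)) : IsNilpotent (c • phi K G e) :=
  ⟨2, by rw [smul_pow, phi_sq, smul_zero]⟩

variable [Fintype E(G)]

theorem IsEnds.XElem_succ (h : G.IsEnds ends) (i : Fin n) :
    XElem K G i.succ = ∑ e, edgeCoeff K (ends e) i • phi K G e := by
  simp only [XElem, h.coeff_eq, edgeCoeff]

theorem IsEnds.sum_XElem (h : G.IsEnds ends) : ∑ i, XElem K G i = 0 := by
  simp only [XElem]
  rw [Finset.sum_comm]
  refine Finset.sum_eq_zero fun e _ => ?_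
  rw [← Finset.sum_smul]
  simp only [h.coeff_eq, Finset.sum_sub_distrib, Finset.sum_ite_eq', Finset.mem_univ, if_true,
    sub_self, zero_smul]

theorem isNilpotent_XElem (i : Fin (n + 1)) : IsNilpotent (XElem K G i) :=
  IsNilpotent.isNilpotent_finsetSum fun e _ => isNilpotent_smul_phi _ e

theorem YElem_eq_exp [Module ℚ (Phi K G)] (i : Fin (n + 1)) :
    YElem K G i = IsNilpotent.exp (XElem K G i) := by
  rw [XElem, IsNilpotent.exp_sum fun e _ => isNilpotent_smul_phi _ e, YElem]
  exact Finset.prod_congr rfl fun e _ => (IsNilpotent.exp_eq_of_sq_eq_zero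
    (by rw [smul_pow, phi_sq, smul_zero])).symm

theorem IsEnds.XElem_mem (h : G.IsEnds ends) (i : Fin (n + 1)) : XElem K G i ∈ CAlg K G := by
  have hs : ∀ j : Fin n, XElem K G j.succ ∈ CAlg K G := fun j => Algebra.subset_adjoin ⟨j, rfl⟩
  cases i using Fin.cases with
  | succ i => exact hs i
  | zero =>
    have := h.sum_XElem (K := K)
    rw [Fin.sum_univ_succ] at this
    rw [eq_neg_of_add_eq_zero_left this]
    exact neg_mem (sum_mem fun j _ => hs j)

theorem IsEnds.CAlg_eq_KAlg [CharZero K] (h : G.IsEnds ends) : CAlg K G = KAlg K G := by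
  let _ : Algebra ℚ (Phi K G) := ((algebraMap K (Phi K G)).comp (algebraMap ℚ K)).toAlgebra
  apply le_antisymm
  · refine Algebra.adjoin_le ?_
    rintro _ ⟨i, rfl⟩
    refine Algebra.adjoin_mono ?_ (IsNilpotent.mem_adjoin_exp K (isNilpotent_XElem i.succ))
    rw [Set.singleton_subset_iff, ← YElem_eq_exp]
    exact ⟨i.succ, rfl⟩
  · refine Algebra.adjoin_le ?_
    rintro _ ⟨i, rfl⟩
    obtain ⟨z, hz, e⟩ := IsNilpotent.exp_eq_one_add K (isNilpotent_XElem (K := K) (G := G) i)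
    have hX := h.XElem_mem (K := K) i
    have hz' : z ∈ CAlg K G := Algebra.adjoin_le (Set.singleton_subset_iff.mpr hX) hz
    simp only [YElem_eq_exp, e]
    exact add_mem (add_mem (one_mem _) hX) (mul_mem (pow_mem hX 2) hz')

theorem familyAlg_univ : familyAlg K (Set.univ : Set (Finset (Fin n))) = ⊤ := by
  rw [eq_top_iff, ← MvPolynomial.adjoin_range_X]
  refine Algebra.adjoin_mono ?_
  rintro _ ⟨i, rfl⟩
  exact ⟨{i}, trivial, by simp [setSum]⟩

theorem isFinsetRing_univ : IsFinsetRing (Set.univ : Set (Finset (Fin n))) :=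
  ⟨trivial, fun _ _ _ _ => trivial, fun _ _ _ _ => trivial⟩

/-- The kernel theorem for the ring of all vertex sets, whose algebra is the full polynomial ring.
-/
theorem IsEnds.ker_eval [CharZero K] (h : G.IsEnds ends) :
    RingHom.ker (evalEdges K ends (phi K G) Finset.univ) = powerIdeal K G := by
  apply le_antisymm
  · intro p hp
    have h1 := (isSquareFree_phi K G).mem_powerSpan (ends := ends) Finset.univ isFinsetRing_univ
      (p := p) (by rw [familyAlg_univ]; trivial) hp
    have h2 : powerSpan K ends Finset.univ Set.univ ≤ (powerIdeal K G).restrictScalars K := by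
      rw [powerSpan, Submodule.span_le]
      rintro _ ⟨I, -, q, -, rfl⟩
      rcases I.eq_empty_or_nonempty with rfl | hI
      -- The empty set gives no generator of the power ideal, but its form is zero and the exponent
      -- is positive.
      · simp [setSum]
      · refine Ideal.mul_mem_left _ _ (Ideal.subset_span ⟨I, hI, ?_⟩)
        rw [h.cutSize_map, setSum]
    exact h2 h1
  · rw [powerIdeal, Ideal.span_le]
    rintro _ ⟨I, -, rfl⟩
    rw [SetLike.mem_coe, RingHom.mem_ker, h.cutSize_map, map_pow]
    exact evalEdges_setSum_pow (phi_sq K G) _ _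

theorem IsEnds.range_eval (h : G.IsEnds ends) :
    (evalEdges K ends (phi K G) Finset.univ).range = CAlg K G := by
  rw [evalEdges, ← Algebra.adjoin_range_eq_range_aeval, CAlg]
  simp only [h.XElem_succ]

theorem IsEnds.nonempty_BAlg_equiv_CAlg [CharZero K] (h : G.IsEnds ends) :
    Nonempty (BAlg K G ≃ₐ[K] CAlg K G) :=
  ⟨(Ideal.quotientEquivAlgOfEq K h.ker_eval.symm).trans
    ((Ideal.quotientKerEquivRange _).trans (Subalgebra.equivOfEq _ _ h.range_eval))⟩

theorem IsEnds.finrank_CAlg [CharZero K] (h : G.IsEnds ends) :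
    Module.finrank K (CAlg K G) = G.spanningForests.ncard := by
  classical
  rw [h.ncard_spanningForests, ← (isSquareFree_phi K G).finrank_eq_card Finset.univ
    isFinsetRing_univ, familyAlg_univ, Algebra.top_toSubmodule, Submodule.map_top,
    ← h.range_eval]
  rfl

end Generators

/-! ### The exponential isomorphism from `D_G` to `B_G` -/

section Exponential

variable {K : Type*} [Field K] {E : Type*} {n : ℕ} {G : Graph (Fin (n + 1)) E}
  {ends : E(G) → Fin (n + 1) × Fin (n + 1)}

theorem pow_eq_zero_of_add_eq_zero {A : Type*} [CommRing A] {a b : A} {k : ℕ} (h : a + b = 0)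
    (hb : b ^ k = 0) : a ^ k = 0 := by
  rw [eq_neg_of_add_eq_zero_left h, neg_pow, hb, mul_zero]

theorem sum_xElem : ∑ i, xElem K G i = 0 := by
  rw [Fin.sum_univ_succ]
  simp [xElem]

theorem sum_xElem_map (J : Finset (Fin n)) : ∑ i ∈ J.map (Fin.succEmb n), xElem K G i =
    Ideal.Quotient.mk (powerIdeal K G) (∑ i ∈ J, MvPolynomial.X i) := by
  rw [Finset.sum_map, map_sum]
  simp [xElem]

theorem exists_map_succEmb {I : Finset (Fin (n + 1))} (h : 0 ∉ I) :
    ∃ J : Finset (Fin n), J.map (Fin.succEmb n) = I := by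
  refine ⟨Finset.univ.filter fun i => i.succ ∈ I, ?_⟩
  ext v
  cases v using Fin.cases with
  | zero => simp [h]
  | succ i => rw [← Fin.coe_succEmb, Finset.mem_map']; exact Finset.mem_filter_univ _

theorem sum_xElem_pow_of_notMem {I : Finset (Fin (n + 1))} (h : 0 ∉ I) :
    (∑ i ∈ I, xElem K G i) ^ (G.cutSize I + 1) = 0 := by
  obtain ⟨J, rfl⟩ := exists_map_succEmb h
  rcases J.eq_empty_or_nonempty with rfl | hJ
  · simp
  · rw [sum_xElem_map, ← map_pow, Ideal.Quotient.eq_zero_iff_mem]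
    exact Ideal.subset_span ⟨J, hJ, rfl⟩

theorem prod_yElem_sub_one_pow {I : Finset (Fin (n + 1))} (hI : I.Nonempty) :
    (∏ i ∈ I, yElem K G i - 1) ^ (G.cutSize I + 1) = 0 := by
  simp only [yElem]
  rw [← map_prod, ← map_one (Ideal.Quotient.mk (multIdeal K G)), ← map_sub, ← map_pow,
    Ideal.Quotient.eq_zero_iff_mem]
  exact Ideal.subset_span ⟨I, hI, rfl⟩

theorem isNilpotent_yElem_sub_one (i : Fin (n + 1)) : IsNilpotent (yElem K G i - 1) :=
  ⟨_, by simpa using prod_yElem_sub_one_pow (K := K) (G := G) (Finset.singleton_nonempty i)⟩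

variable [Fintype E(G)]

/-- For `I` containing `0`, the relation `∑ x_i = 0` passes to the complement, which has the same
cut. -/
theorem IsEnds.sum_xElem_pow (h : G.IsEnds ends) (I : Finset (Fin (n + 1))) :
    (∑ i ∈ I, xElem K G i) ^ (G.cutSize I + 1) = 0 := by
  by_cases h0 : 0 ∈ I
  · refine pow_eq_zero_of_add_eq_zero ((Finset.sum_add_sum_compl I _).trans sum_xElem) ?_
    rw [← h.cutSize_compl]
    exact sum_xElem_pow_of_notMem (by simpa using h0)
  · exact sum_xElem_pow_of_notMem h0

theorem IsEnds.isNilpotent_xElem (h : G.IsEnds ends) (i : Fin (n + 1)) :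
    IsNilpotent (xElem K G i) :=
  ⟨_, by simpa using h.sum_xElem_pow {i}⟩

/-- No edge leaves the full vertex set, so its relation has exponent one. -/
theorem IsEnds.prod_yElem (h : G.IsEnds ends) : ∏ i, yElem K G i = 1 := by
  have h1 := prod_yElem_sub_one_pow (K := K) (G := G) Finset.univ_nonempty
  have h2 : G.cutSize Finset.univ = 0 := by rw [h.cutSize_eq]; simp
  rw [h2, zero_add, pow_one] at h1
  exact sub_eq_zero.mp h1

variable [CharZero K]

theorem IsEnds.exists_algHom_D [Module ℚ (BAlg K G)] (h : G.IsEnds ends) :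
    ∃ ψ : DAlg K G →ₐ[K] BAlg K G, ∀ i, ψ (yElem K G i) = IsNilpotent.exp (xElem K G i) := by
  refine ⟨Ideal.Quotient.liftₐ _
    (MvPolynomial.aeval fun i => IsNilpotent.exp (xElem K G i)) fun p hp => ?_, fun i => ?_⟩
  · have : multIdeal K G ≤ RingHom.ker
        (MvPolynomial.aeval (R := K) fun i => IsNilpotent.exp (xElem K G i)) := by
      rw [multIdeal, Ideal.span_le]
      rintro _ ⟨I, -, rfl⟩
      have hn := fun i (_ : i ∈ I) => h.isNilpotent_xElem (K := K) i
      obtain ⟨u, -, hu⟩ := IsNilpotent.exp_sub_one_eq_mul_unit K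
        (IsNilpotent.isNilpotent_finsetSum hn)
      rw [SetLike.mem_coe, RingHom.mem_ker]
      simp only [map_pow, map_sub, map_prod, MvPolynomial.aeval_X, map_one]
      rw [← IsNilpotent.exp_sum hn, hu, mul_pow, h.sum_xElem_pow, zero_mul]
    exact this hp
  · exact MvPolynomial.aeval_X _ _

/-- Send `x_i` to a nilpotent logarithm `l i` of `y_i`. As `∏ y_i = 1`, injectivity of `exp` gives
`∑ l i = 0`, which makes the value at `x_0` correct too. -/
theorem IsEnds.exists_algHom_B [Module ℚ (DAlg K G)] (h : G.IsEnds ends) :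
    ∃ χ : BAlg K G →ₐ[K] DAlg K G, ∀ i, IsNilpotent (χ (xElem K G i)) ∧
      IsNilpotent.exp (χ (xElem K G i)) = yElem K G i := by
  choose l hl hexp using fun i => IsNilpotent.exists_exp_eq K
    (isNilpotent_yElem_sub_one (K := K) (G := G) i)
  have hsum : ∑ i, l i = 0 := by
    refine IsNilpotent.exp_injective K (IsNilpotent.isNilpotent_finsetSum fun i _ => hl i)
      IsNilpotent.zero ?_
    rw [IsNilpotent.exp_sum fun i _ => hl i, IsNilpotent.exp_zero]
    simp only [hexp, h.prod_yElem]
  have hker : powerIdeal K G ≤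
      RingHom.ker (MvPolynomial.aeval (R := K) fun i : Fin n => l i.succ) := by
    rw [powerIdeal, Ideal.span_le]
    rintro _ ⟨J, hJ, rfl⟩
    have hn := fun i (_ : i ∈ J.map (Fin.succEmb n)) => hl i
    obtain ⟨u, hu, e⟩ := IsNilpotent.exp_sub_one_eq_mul_unit K
      (IsNilpotent.isNilpotent_finsetSum hn)
    have hp := prod_yElem_sub_one_pow (K := K) (G := G) (hJ.map (f := Fin.succEmb n))
    rw [IsNilpotent.exp_sum hn] at e
    simp only [hexp] at e
    rw [e, mul_pow, (hu.pow _).mul_left_eq_zero, Finset.sum_map] at hp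
    rw [SetLike.mem_coe, RingHom.mem_ker]
    simpa using hp
  have hχ : ∃ χ : BAlg K G →ₐ[K] DAlg K G, ∀ i : Fin n, χ (xElem K G i.succ) = l i.succ :=
    ⟨Ideal.Quotient.liftₐ _ (MvPolynomial.aeval fun i : Fin n => l i.succ) fun p hp => hker hp,
      fun i => MvPolynomial.aeval_X _ _⟩
  obtain ⟨χ, hχ⟩ := hχ
  have hall : ∀ i, χ (xElem K G i) = l i := by
    intro i
    cases i using Fin.cases with
    | succ i => exact hχ i
    | zero =>
      have h1 := sum_xElem (K := K) (G := G)
      rw [Fin.sum_univ_succ] at h1 hsum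
      rw [eq_neg_of_add_eq_zero_left h1, eq_neg_of_add_eq_zero_left hsum, map_neg, map_sum]
      simp only [hχ]
  exact ⟨χ, fun i => by rw [hall]; exact ⟨hl i, hexp i⟩⟩

theorem IsEnds.exists_equiv [Module ℚ (BAlg K G)] (h : G.IsEnds ends) :
    ∃ ψ : DAlg K G ≃ₐ[K] BAlg K G, ∀ i, ψ (yElem K G i) = IsNilpotent.exp (xElem K G i) := by
  let _ : Algebra ℚ (DAlg K G) := ((algebraMap K (DAlg K G)).comp (algebraMap ℚ K)).toAlgebra
  obtain ⟨ψ, hψ⟩ := h.exists_algHom_D (K := K)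
  obtain ⟨χ, hχ⟩ := h.exists_algHom_B (K := K)
  refine ⟨AlgEquiv.ofAlgHom ψ χ ?_ ?_, hψ⟩
  · refine Ideal.Quotient.algHom_ext _ (MvPolynomial.algHom_ext fun i => ?_)
    have hx := h.isNilpotent_xElem (K := K) i.succ
    change ψ (χ (xElem K G i.succ)) = xElem K G i.succ
    refine IsNilpotent.exp_injective K ((hχ i.succ).1.map ψ) hx ?_
    rw [← IsNilpotent.map_exp (hχ i.succ).1, (hχ i.succ).2, hψ]
  · refine Ideal.Quotient.algHom_ext _ (MvPolynomial.algHom_ext fun i => ?_)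
    change χ (ψ (yElem K G i)) = yElem K G i
    rw [hψ, IsNilpotent.map_exp (h.isNilpotent_xElem i), (hχ i).2]

end Exponential

end Graph

/-! ### The main theorem -/

theorem mainTheorem3 {K : Type*} [Field K] [CharZero K] {n : ℕ} {E : Type*}
    (G : Graph (Fin (n + 1)) E) (hV : V(G) = Set.univ) [Fintype E(G)] [G.Loopless] :
    -- the four algebras are isomorphic
    Nonempty (Graph.BAlg K G ≃ₐ[K] Graph.CAlg K G) ∧
    Nonempty (Graph.CAlg K G ≃ₐ[K] Graph.DAlg K G) ∧
    Nonempty (Graph.DAlg K G ≃ₐ[K] Graph.KAlg K G) ∧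
    -- they are finite-dimensional, of dimension the number of spanning forests
    Module.Finite K (Graph.BAlg K G) ∧
    Module.finrank K (Graph.BAlg K G) = G.spanningForests.ncard ∧
    Module.finrank K (Graph.CAlg K G) = G.spanningForests.ncard ∧
    Module.finrank K (Graph.DAlg K G) = G.spanningForests.ncard ∧
    Module.finrank K (Graph.KAlg K G) = G.spanningForests.ncard ∧
    -- `C_G` and `K_G` are the same subset of `Φ_G`
    Graph.CAlg K G = Graph.KAlg K G ∧
    -- `y_i - 1 ↦ exp (x_i) - 1` defines an isomorphism from `D_G` to `B_G`
    (∀ i, IsNilpotent (Graph.xElem K G i)) ∧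
    ∃ ψ : Graph.DAlg K G ≃ₐ[K] Graph.BAlg K G,
      ∀ i, ψ (Graph.yElem K G i - 1) = IsNilpotent.exp (Graph.xElem K G i) - 1 := by
  obtain ⟨ends, h⟩ := G.exists_isEnds
  obtain ⟨β⟩ := h.nonempty_BAlg_equiv_CAlg (K := K)
  obtain ⟨ψ, hψ⟩ := h.exists_equiv (K := K)
  have hCK := h.CAlg_eq_KAlg (K := K)
  have hC := h.finrank_CAlg (K := K)
  have hB : Module.finrank K (Graph.BAlg K G) = G.spanningForests.ncard := by
    rw [← hC, β.toLinearEquiv.finrank_eq]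
  refine ⟨⟨β⟩, ⟨(ψ.trans β).symm⟩, ⟨(ψ.trans β).trans (Subalgebra.equivOfEq _ _ hCK)⟩,
    Module.Finite.equiv β.symm.toLinearEquiv, hB, hC, ?_, hCK ▸ hC, hCK, h.isNilpotent_xElem, ψ,
    fun i => by rw [map_sub, hψ, map_one]⟩
  rw [← hB, ψ.toLinearEquiv.finrank_eq]
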